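/- Let $0<\alpha<2$ and $c>0$, and let $(X_n)_{n\ge1}$ be real random variables on a probability space $(\Omega,\mathcal F,P)$. Suppose that $(X_n)$ is \emph{determining}: for every event $A$ with $P(A)>0$ there is a (proper) distribution function $F_A$ such that $P(X_n<t\mid A)\to F_A(t)$ as $n\to\infty$ at every continuity point $t$ of $F_A$. Let $\mu$ be its \emph{limit random measure}, that is, a measurable map $\omega\mapsto\mu(\omega)$ into the probability measures on $\mathbb R$ such that for all $t$ in some countable dense set of continuity points of $F_\Omega$ the indicators $I\{X_n\le t\}$ converge weakly in $L^\infty$ to $\mu((-\infty,t])$, i.e. $E(I\{X_n\le t\}\,\eta)\to E(\mu((-\infty,t])\,\eta)$ for every integrable random variable $\eta$. Assume that with probability one $\mu$ belongs to the class $S(\alpha,c)$ of symmetric probability distributions on $\mathbb R$ whose characteristic function $\varphi$ satisfies $$\varphi(t)=1-c|t|^\alpha+o(|t|^\alpha)\qquad (t\to0).$$ Then there is a subsequence $(X_{n_k})$, $n_1<n_2<\cdots$, such that for every real sequence $(a_k)$, not identically zero, satisfying $$\max_{1\le k\le N}|a_k|=o(A_N)\quad(N\to\infty),\qquad A_N=\Big(\sum_{k=1}^N|a_k|^\alpha\Big)^{1/\alpha},$$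 we have $$A_N^{-1}\sum_{k=1}^N a_kX_{n_k}\ \xrightarrow{d}\ G_{\alpha,c}\qquad(N\to\infty),$$ where $G_{\alpha,c}$ is the probability distribution on $\mathbb R$ with characteristic function $\exp(-c|t|^\alpha)$. The same subsequence serves all such $(a_k)$. -/

import Mathlib

open MeasureTheory ProbabilityTheory Filter Topology Asymptotics

noncomputable section

namespace SubseqStable

variable {Ω : Type*} [MeasurableSpace Ω]

/-- `t` is a continuity point of the distribution function `s ↦ ν (-∞, s)`. -/
def IsContPoint (ν : Measure ℝ) (t : ℝ) : Prop :=
  ContinuousAt (fun s : ℝ => ν.real (Set.Iio s)) t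

/-- `ν` is the limit distribution of `(X n)` relative to the event `A`:
`P(X n < t | A) → F_A(t) = ν (-∞, t)` at every continuity point `t` of `F_A`. -/
def IsLimitDistRel (P : Measure Ω) (X : ℕ → Ω → ℝ) (A : Set Ω) (ν : Measure ℝ) : Prop :=
  IsProbabilityMeasure ν ∧
    ∀ t : ℝ, IsContPoint ν t →
      Tendsto (fun n => (P[|A]).real {ω | X n ω < t}) atTop (𝓝 (ν.real (Set.Iio t)))

/-- A sequence of random variables is determining if it has a limit distribution relative to
every event of positive probability. -/
def IsDetermining (P : Measure Ω) (X : ℕ → Ω → ℝ) : Prop :=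
  ∀ A : Set Ω, MeasurableSet A → 0 < P A → ∃ ν : Measure ℝ, IsLimitDistRel P X A ν

/-- Weak convergence in `L^∞` of bounded random variables:
`E(ξ n * η) → E(ξ' * η)` for every integrable `η`. -/
def WeakLinftyTendsto (P : Measure Ω) (ξ : ℕ → Ω → ℝ) (ξ' : Ω → ℝ) : Prop :=
  ∀ η : Ω → ℝ, Integrable η P →
    Tendsto (fun n => ∫ ω, ξ n ω * η ω ∂P) atTop (𝓝 (∫ ω, ξ' ω * η ω ∂P))

/-- The random probability measure `μ` is a limit random measure of `(X n)`: for some countable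
dense set `D` of continuity points of the limit distribution function `F_Ω`, the indicators
`I{X n ≤ t}`, `t ∈ D`, converge weakly in `L^∞` to `G_t = μ (-∞, t]`. -/
def IsLimitRandomMeasure (P : Measure Ω) (X : ℕ → Ω → ℝ) (μ : Kernel Ω ℝ) : Prop :=
  IsMarkovKernel μ ∧
    ∃ ν : Measure ℝ, IsLimitDistRel P X Set.univ ν ∧
      ∃ D : Set ℝ, D.Countable ∧ Dense D ∧ ∀ t ∈ D, IsContPoint ν t ∧
        WeakLinftyTendsto P (fun n => Set.indicator {ω | X n ω ≤ t} 1)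
          (fun ω => (μ ω).real (Set.Iic t))

/-- The class `S(α, c)` of symmetric probability distributions on `ℝ` with characteristic function
`φ(t) = 1 - c |t|^α + o(|t|^α)` as `t → 0`. -/
def stableClass (α c : ℝ) : Set (Measure ℝ) :=
  {ν | IsProbabilityMeasure ν ∧ ν.map (fun x => -x) = ν ∧
    (fun t : ℝ => charFun ν t - ((1 - c * |t| ^ α : ℝ) : ℂ)) =o[𝓝 0] (fun t : ℝ => |t| ^ α)}

/-- `A_N = (∑ |a_k|^α)^{1/α}`, the sum running over the first `N` weights. -/
def weightNorm (α : ℝ) (a : ℕ → ℝ) (N : ℕ) : ℝ :=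
  (∑ k ∈ Finset.range N, |a k| ^ α) ^ (1 / α)

/-- The maximum of `|a_k|` over the first `N` weights. -/
def weightMax (a : ℕ → ℝ) (N : ℕ) : ℝ :=
  ((Finset.range N).sup (fun k => ‖a k‖₊) : NNReal)

end SubseqStable

end

/-! Far along the sequence, `X n` behaves like a draw from the random measure μ independent of
whatever is already fixed: if φ_ω is the characteristic function of μ(ω), then E[Y exp(iuX_n)] → E[Y
φ_ω(u)] for every integrable Y. Continuity and tightness make this uniform when Y and u depend
continuously on a parameter in a compact set (`IsLimitRandomMeasure.eventually_norm_integral_lt`).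
With the cube [-1,1]^ℕ as parameter space, the terms n_k can be chosen inductively with replacement
error at most 2^{-k} for all coefficients at once
(`IsLimitRandomMeasure.exists_isAlmostExchangeable`). This is why one subsequence serves every
weight sequence.

It remains to replace φ_ω(t) by the deterministic ψ(t) = exp(-c|t|^α), which then factors out of the
expectation, so that the factors are peeled off one by one
(`IsAlmostExchangeable.norm_integral_sub_le`). The error o(|t|^α) is not uniform in ω. On the event
A_M where |φ_ω - ψ| ≤ M|t|^α, dominated convergence gives E[1_{A_M} |φ_ω(t) - ψ(t)|] = o(|t|^α). For
t_j = s a_j / A_N the sum of |t_j|^α is |s|^α and max |t_j| → 0, so these errors add up to o(1). The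
first M factors tend to 1, the selection errors after M sum to O(2^{-M}), and P(A_M) → 1. Letting N
→ ∞ and then M → ∞ yields exp(-c|s|^α). -/

noncomputable section

namespace SubseqStable

/-! ### Stable convergence of test functions and its closure properties -/

section

variable {Ω : Type*} [MeasurableSpace Ω]

/-- Stable convergence of `h (X n)` to `∫ h dμ` for a bounded measurable test function `h`,
tested against complex integrable random variables. -/
structure StablyConverges (P : Measure Ω) (X : ℕ → Ω → ℝ) (μ : Kernel Ω ℝ) (h : ℝ → ℂ) :
    Prop where
  measurable : Measurable h
  bounded : ∃ C, ∀ x, ‖h x‖ ≤ C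
  tendsto : ∀ η : Ω → ℂ, Integrable η P →
    Tendsto (fun n => ∫ ω, h (X n ω) * η ω ∂P) atTop (𝓝 (∫ ω, (∫ x, h x ∂(μ ω)) * η ω ∂P))

section

variable {P : Measure Ω} {X : ℕ → Ω → ℝ} {μ : Kernel Ω ℝ}

lemma integrable_comp_mul {h : ℝ → ℂ} (hm : Measurable h) (hb : ∃ C, ∀ x, ‖h x‖ ≤ C)
    {Y : Ω → ℝ} (hY : Measurable Y) {η : Ω → ℂ} (hη : Integrable η P) :
    Integrable (fun ω => h (Y ω) * η ω) P := by
  obtain ⟨C, hC⟩ := hb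
  exact hη.bdd_mul (hm.comp hY).aestronglyMeasurable (ae_of_all _ fun ω => hC _)

lemma norm_integral_le_of_bound [IsMarkovKernel μ] {h : ℝ → ℂ} {C : ℝ} (hC : ∀ x, ‖h x‖ ≤ C) (ω : Ω) :
    ‖∫ x, h x ∂(μ ω)‖ ≤ C := by
  simpa using norm_integral_le_of_norm_le_const (μ := μ ω) (ae_of_all _ hC)

lemma integrable_kernel_integral_mul [IsMarkovKernel μ] {h : ℝ → ℂ} (hm : Measurable h) (hb : ∃ C, ∀ x, ‖h x‖ ≤ C)
    {η : Ω → ℂ} (hη : Integrable η P) :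
    Integrable (fun ω => (∫ x, h x ∂(μ ω)) * η ω) P := by
  obtain ⟨C, hC⟩ := hb
  exact hη.bdd_mul (hm.stronglyMeasurable.integral_kernel (κ := μ)).aestronglyMeasurable
    (ae_of_all _ fun ω => norm_integral_le_of_bound hC ω)

lemma integrable_of_bound {h : ℝ → ℂ} (hm : Measurable h) (hb : ∃ C, ∀ x, ‖h x‖ ≤ C)
    (ν : Measure ℝ) [IsFiniteMeasure ν] : Integrable h ν := by
  obtain ⟨C, hC⟩ := hb
  exact Integrable.of_bound hm.aestronglyMeasurable C (ae_of_all _ hC)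

namespace StablyConverges

lemma const [IsMarkovKernel μ] (z : ℂ) : StablyConverges P X μ (fun _ => z) where
  measurable := measurable_const
  bounded := ⟨‖z‖, fun _ => le_rfl⟩
  tendsto η hη := by simp

lemma add [IsMarkovKernel μ] (hX : ∀ n, Measurable (X n)) {g h : ℝ → ℂ} (hg : StablyConverges P X μ g)
    (hh : StablyConverges P X μ h) : StablyConverges P X μ (fun x => g x + h x) where
  measurable := hg.measurable.add hh.measurable
  bounded := by
    obtain ⟨C, hC⟩ := hg.bounded
    obtain ⟨C', hC'⟩ := hh.bounded
    exact ⟨C + C', fun x => (norm_add_le _ _).trans (add_le_add (hC x) (hC' x))⟩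
  tendsto η hη := by
    have key := (hg.tendsto η hη).add (hh.tendsto η hη)
    rw [← integral_add (integrable_kernel_integral_mul hg.measurable hg.bounded hη)
      (integrable_kernel_integral_mul hh.measurable hh.bounded hη)] at key
    refine (key.congr fun n => ?_).trans_eq ?_
    · rw [← integral_add (integrable_comp_mul hg.measurable hg.bounded (hX n) hη)
        (integrable_comp_mul hh.measurable hh.bounded (hX n) hη)]
      simp_rw [add_mul]
    · congr 2
      ext ω
      rw [integral_add (integrable_of_bound hg.measurable hg.bounded _)
        (integrable_of_bound hh.measurable hh.bounded _), add_mul]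

lemma const_mul (z : ℂ) {h : ℝ → ℂ} (hh : StablyConverges P X μ h) :
    StablyConverges P X μ (fun x => z * h x) where
  measurable := hh.measurable.const_mul z
  bounded := by
    obtain ⟨C, hC⟩ := hh.bounded
    exact ⟨‖z‖ * C, fun x => by rw [norm_mul]; gcongr; exact hC x⟩
  tendsto η hη := by
    have key := (hh.tendsto η hη).const_mul z
    simpa only [← integral_const_mul, mul_assoc, MeasureTheory.integral_const_mul] using key

lemma sub [IsMarkovKernel μ] (hX : ∀ n, Measurable (X n)) {g h : ℝ → ℂ} (hg : StablyConverges P X μ g)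
    (hh : StablyConverges P X μ h) : StablyConverges P X μ (fun x => g x - h x) := by
  simpa [sub_eq_add_neg] using hg.add hX (hh.const_mul (-1))

lemma sum [IsMarkovKernel μ] (hX : ∀ n, Measurable (X n)) {g : ℕ → ℝ → ℂ} (hg : ∀ j, StablyConverges P X μ (g j))
    (m : ℕ) : StablyConverges P X μ (fun x => ∑ j ∈ Finset.range m, g j x) := by
  induction m with
  | zero => simpa using const 0
  | succ m ih => simpa only [Finset.sum_range_succ] using ih.add hX (hg m)

/-- A three-epsilon argument. The error bound `b` must itself converge stably: then its integral
along `X n` is eventually as small as its integral against μ. -/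
lemma of_approx [IsMarkovKernel μ] (hX : ∀ n, Measurable (X n)) {h : ℝ → ℂ} (hm : Measurable h)
    (hb : ∃ C, ∀ x, ‖h x‖ ≤ C)
    (happ : ∀ η : Ω → ℂ, Integrable η P → ∀ ε > 0, ∃ (g : ℝ → ℂ) (b : ℝ → ℝ),
      StablyConverges P X μ g ∧ StablyConverges P X μ (fun x => (b x : ℂ)) ∧
      (∀ x, ‖h x - g x‖ ≤ b x) ∧ ∫ ω, (∫ x, b x ∂(μ ω)) * ‖η ω‖ ∂P < ε) :
    StablyConverges P X μ h := by
  refine ⟨hm, hb, fun η hη => ?_⟩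
  rw [Metric.tendsto_atTop']
  intro ε hε
  obtain ⟨g, b, hg, hbc, hle, hsmall⟩ := happ η hη (ε / 3) (by positivity)
  have hbm : Measurable b := Complex.measurable_re.comp hbc.measurable
  have hbint (ν : Measure ℝ) [IsFiniteMeasure ν] : Integrable b ν := by
    simpa using (integrable_of_bound hbc.measurable hbc.bounded ν).re
  have hnorm : Integrable (fun ω => (‖η ω‖ : ℂ)) P := hη.norm.ofReal
  have hbX : Tendsto (fun n => ∫ ω, b (X n ω) * ‖η ω‖ ∂P) atTop
      (𝓝 (∫ ω, (∫ x, b x ∂(μ ω)) * ‖η ω‖ ∂P)) := by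
    have := (Complex.continuous_re.tendsto _).comp (hbc.tendsto _ hnorm)
    simpa only [Function.comp_def, integral_complex_ofReal, ← Complex.ofReal_mul,
      Complex.ofReal_re] using this
  have h1 := hbX.eventually_lt_const hsmall
  have h2 := (Metric.tendsto_atTop'.1 (hg.tendsto η hη)) (ε / 3) (by positivity)
  obtain ⟨N1, hN1⟩ := eventually_atTop.1 h1
  obtain ⟨N2, hN2⟩ := h2
  refine ⟨max N1 N2, fun n hn => ?_⟩
  have e1 := hN1 n (by grind)
  have e2 := hN2 n (by grind)
  have e3 : dist (∫ ω, h (X n ω) * η ω ∂P) (∫ ω, g (X n ω) * η ω ∂P)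
      ≤ ∫ ω, b (X n ω) * ‖η ω‖ ∂P := by
    rw [dist_eq_norm, ← integral_sub (integrable_comp_mul hm hb (hX n) hη)
      (integrable_comp_mul hg.measurable hg.bounded (hX n) hη)]
    refine norm_integral_le_of_norm_le ?_ (ae_of_all _ fun ω => ?_)
    · have := (integrable_comp_mul hbc.measurable hbc.bounded (hX n) hnorm).re
      simpa using this
    · rw [← sub_mul, norm_mul]
      gcongr
      exact hle _
  have e4 : dist (∫ ω, (∫ x, g x ∂(μ ω)) * η ω ∂P) (∫ ω, (∫ x, h x ∂(μ ω)) * η ω ∂P)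
      ≤ ∫ ω, (∫ x, b x ∂(μ ω)) * ‖η ω‖ ∂P := by
    rw [dist_comm, dist_eq_norm, ← integral_sub (integrable_kernel_integral_mul hm hb hη)
      (integrable_kernel_integral_mul hg.measurable hg.bounded hη)]
    refine norm_integral_le_of_norm_le ?_ (ae_of_all _ fun ω => ?_)
    · have := (integrable_kernel_integral_mul (μ := μ) hbc.measurable hbc.bounded hnorm).re
      simpa [integral_complex_ofReal, ← Complex.ofReal_mul] using this
    · rw [← sub_mul, norm_mul, ← integral_sub (integrable_of_bound hm hb _)
        (integrable_of_bound hg.measurable hg.bounded _)]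
      gcongr
      exact norm_integral_le_of_norm_le (hbint _) (ae_of_all _ hle)
  calc _ ≤ _ + _ + _ := dist_triangle4 _ _ _ _
    _ < ε := by linarith

end StablyConverges

lemma WeakLinftyTendsto.stablyConverges [IsMarkovKernel μ] {t : ℝ}
    (hX : ∀ n, Measurable (X n))
    (h : WeakLinftyTendsto P (fun n => Set.indicator {ω | X n ω ≤ t} 1)
          (fun ω => (μ ω).real (Set.Iic t))) :
    StablyConverges P X μ (Set.indicator (Set.Iic t) 1) where
  measurable := measurable_one.indicator measurableSet_Iic
  bounded := ⟨1, fun x => by by_cases hx : x ≤ t <;> simp [hx]⟩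
  tendsto η hη := by
    have hsplit (f : Ω → ℝ) (hf : Measurable f) (hf1 : ∀ ω, ‖f ω‖ ≤ 1) :
        ∫ ω, (f ω : ℂ) * η ω ∂P
          = ((∫ ω, f ω * (η ω).re ∂P : ℝ) : ℂ) + ((∫ ω, f ω * (η ω).im ∂P : ℝ) : ℂ) * Complex.I := by
      rw [← integral_re_add_im (𝕜 := ℂ)]
      · simp
      · exact hη.bdd_mul (c := 1) (by fun_prop) (ae_of_all _ fun ω => by simpa using hf1 ω)
    have hre := h _ hη.re
    have him := h _ hη.im
    have key := ((Complex.continuous_ofReal.tendsto _).comp hre).add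
      (((Complex.continuous_ofReal.tendsto _).comp him).mul_const Complex.I)
    refine (key.congr fun n => ?_).trans_eq ?_
    · simp only [Function.comp]
      refine ((hsplit (Set.indicator {ω | X n ω ≤ t} 1) ?_ ?_).symm).trans ?_
      · exact measurable_one.indicator (measurableSet_le (hX n) measurable_const)
      · intro ω
        by_cases hx : X n ω ≤ t <;> simp [hx]
      · congr 1
        ext ω
        by_cases hx : X n ω ≤ t <;> simp [hx]
    · congr 1
      refine ((hsplit (fun ω => (μ ω).real (Set.Iic t)) ?_ ?_).symm).trans ?_
      · exact (μ.measurable_coe measurableSet_Iic).ennreal_toReal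
      · intro ω
        rw [Real.norm_of_nonneg measureReal_nonneg]
        exact measureReal_le_one
      · congr 1
        ext ω
        simp [integral_indicator measurableSet_Iic]

end

end

/-! ### From half-line indicators to exponentials -/

section

variable {Ω : Type*} [MeasurableSpace Ω]

lemma tendsto_measureReal_compl_Ioc (ν : Measure ℝ) [IsFiniteMeasure ν] :
    Tendsto (fun R : ℕ => ν.real (Set.Ioc (-R : ℝ) R)ᶜ) atTop (𝓝 0) := by
  have hanti : Antitone (fun R : ℕ => (Set.Ioc (-R : ℝ) R)ᶜ) := by
    intro R S hRS
    refine Set.compl_subset_compl.2 (Set.Ioc_subset_Ioc ?_ ?_)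
    · simpa using hRS
    · simpa using hRS
  have hempty : ⋂ R : ℕ, (Set.Ioc (-R : ℝ) R)ᶜ = ∅ := by
    rw [← Set.compl_iUnion, Set.compl_empty_iff, Set.eq_univ_iff_forall]
    intro x
    obtain ⟨R, hR⟩ := exists_nat_gt |x|
    exact Set.mem_iUnion.2 ⟨R, (abs_lt.1 hR).1, (abs_lt.1 hR).2.le⟩
  have key := tendsto_measure_iInter_atTop (μ := ν)
    (fun R : ℕ => (measurableSet_Ioc (a := (-R : ℝ)) (b := R)).compl.nullMeasurableSet) hanti
    ⟨0, measure_ne_top _ _⟩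
  rw [hempty, measure_empty] at key
  simpa [Measure.real, Function.comp_def] using (ENNReal.tendsto_toReal ENNReal.zero_ne_top).comp key

lemma tendsto_integral_measureReal_compl_Ioc {P : Measure Ω} {μ : Kernel Ω ℝ} [IsMarkovKernel μ]
    {η : Ω → ℂ} (hη : Integrable η P) :
    Tendsto (fun R : ℕ => ∫ ω, (μ ω).real (Set.Ioc (-R : ℝ) R)ᶜ * ‖η ω‖ ∂P) atTop (𝓝 0) := by
  have key := tendsto_integral_filter_of_dominated_convergence (μ := P) (l := atTop)
    (F := fun (R : ℕ) ω => (μ ω).real (Set.Ioc (-R : ℝ) R)ᶜ * ‖η ω‖) (f := fun _ => 0)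
    (fun ω => ‖η ω‖) ?_ ?_ hη.norm ?_
  · simpa using key
  · refine Eventually.of_forall fun R => AEStronglyMeasurable.mul ?_ hη.norm.aestronglyMeasurable
    exact (μ.measurable_coe measurableSet_Ioc.compl).ennreal_toReal.aestronglyMeasurable
  · refine Eventually.of_forall fun R => ae_of_all _ fun ω => ?_
    rw [Real.norm_of_nonneg (by positivity)]
    exact mul_le_of_le_one_left (norm_nonneg _) measureReal_le_one
  · refine ae_of_all _ fun ω => ?_
    simpa using (tendsto_measureReal_compl_Ioc (μ ω)).mul_const ‖η ω‖

/-- The cells are disjoint, so at each point at most one summand is nonzero; there `f` is compared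
with its value at the left endpoint. -/
lemma norm_indicator_sub_step_le {f : ℝ → ℂ} {L δ : ℝ} (hL : ∀ x y, ‖f x - f y‖ ≤ L * |x - y|)
    (hL0 : 0 ≤ L) {d : ℕ → ℝ} (hd : Monotone d) (hδ : ∀ j, d (j + 1) - d j ≤ δ) (m : ℕ) (x : ℝ) :
    ‖Set.indicator (Set.Ioc (d 0) (d m)) f x
      - ∑ j ∈ Finset.range m, f (d j) * Set.indicator (Set.Ioc (d j) (d (j + 1))) 1 x‖ ≤ L * δ := by
  have hδ0 : 0 ≤ δ := (sub_nonneg.2 (hd (Nat.le_succ 0))).trans (hδ 0)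
  induction m with
  | zero => simpa using by positivity
  | succ m ih =>
    rw [Finset.sum_range_succ]
    by_cases hx : x ≤ d m
    · have h1 : x ∉ Set.Ioc (d m) (d (m + 1)) := fun h => absurd h.1 (not_lt.2 hx)
      have h2 : x ∈ Set.Ioc (d 0) (d (m + 1)) ↔ x ∈ Set.Ioc (d 0) (d m) :=
        ⟨fun h => ⟨h.1, hx⟩, fun h => ⟨h.1, hx.trans (hd (Nat.le_succ m))⟩⟩
      have h3 : Set.indicator (Set.Ioc (d 0) (d (m + 1))) f x
          = Set.indicator (Set.Ioc (d 0) (d m)) f x := by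
        by_cases h : x ∈ Set.Ioc (d 0) (d m)
        · rw [Set.indicator_of_mem h, Set.indicator_of_mem (h2.2 h)]
        · rw [Set.indicator_of_notMem h, Set.indicator_of_notMem (fun h' => h (h2.1 h'))]
      rw [h3, Set.indicator_of_notMem h1, mul_zero, add_zero]
      exact ih
    · push Not at hx
      have h1 : ∑ j ∈ Finset.range m, f (d j) * Set.indicator (Set.Ioc (d j) (d (j + 1))) 1 x = 0 := by
        refine Finset.sum_eq_zero fun j hj => ?_
        have : x ∉ Set.Ioc (d j) (d (j + 1)) := fun h =>
          absurd (h.2.trans (hd (Finset.mem_range.1 hj))) (not_le.2 hx)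
        rw [Set.indicator_of_notMem this, mul_zero]
      rw [h1, zero_add]
      by_cases hx' : x ≤ d (m + 1)
      · have h2 : x ∈ Set.Ioc (d 0) (d (m + 1)) := ⟨(hd (Nat.zero_le m)).trans_lt hx, hx'⟩
        have h3 : x ∈ Set.Ioc (d m) (d (m + 1)) := ⟨hx, hx'⟩
        rw [Set.indicator_of_mem h2, Set.indicator_of_mem h3, Pi.one_apply, mul_one]
        refine (hL _ _).trans ?_
        gcongr
        rw [abs_of_nonneg (by linarith)]
        linarith [hδ m]
      · rw [Set.indicator_of_notMem (fun h => hx' h.2), Set.indicator_of_notMem (fun h => hx' h.2)]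
        simpa using by positivity

/-- One point of `D` in each of the adjacent windows of width `δ`: the points increase, consecutive
gaps are below `2 * δ`, and the first lies left of `-R`. -/
lemma exists_seq_mem_Ioo {D : Set ℝ} (hD : Dense D) (R : ℝ) {δ : ℝ} (hδ : 0 < δ) :
    ∃ d : ℕ → ℝ, (∀ j, d j ∈ D) ∧ ∀ j : ℕ, -R + (j - 1) * δ < d j ∧ d j < -R + j * δ := by
  have h (j : ℕ) : ∃ x ∈ D, -R + ((j : ℝ) - 1) * δ < x ∧ x < -R + j * δ := by
    obtain ⟨x, hx, hx'⟩ := hD.exists_between (show -R + ((j : ℝ) - 1) * δ < -R + j * δ by nlinarith)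
    exact ⟨x, hx, hx'⟩
  choose d hd using h
  exact ⟨d, fun j => (hd j).1, fun j => (hd j).2⟩

lemma StablyConverges.of_lipschitz {P : Measure Ω} {X : ℕ → Ω → ℝ} {μ : Kernel Ω ℝ}
    [IsMarkovKernel μ] (hX : ∀ n, Measurable (X n)) {D : Set ℝ} (hD : Dense D)
    (hDconv : ∀ t ∈ D, StablyConverges P X μ (Set.indicator (Set.Iic t) 1))
    {f : ℝ → ℂ} (hf : Measurable f) (hf1 : ∀ x, ‖f x‖ ≤ 1) {L : ℝ} (hL0 : 0 ≤ L)
    (hL : ∀ x y, ‖f x - f y‖ ≤ L * |x - y|) : StablyConverges P X μ f := by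
  refine StablyConverges.of_approx hX hf ⟨1, hf1⟩ fun η hη ε hε => ?_
  have hηpos : 0 ≤ ∫ ω, ‖η ω‖ ∂P := integral_nonneg fun _ => norm_nonneg _
  -- `R` controls the mass of μ outside a bounded interval, `δ` the oscillation of `f` inside it;
  -- each costs at most `ε / 2`.
  obtain ⟨R, hR⟩ := ((tendsto_integral_measureReal_compl_Ioc (μ := μ) hη).eventually_lt_const
    (half_pos hε)).exists
  obtain ⟨δ, hδ, hδε⟩ : ∃ δ > 0, L * (2 * δ) * ∫ ω, ‖η ω‖ ∂P < ε / 2 := by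
    refine ⟨ε / (4 * (L * (∫ ω, ‖η ω‖ ∂P) + 1)), by positivity, ?_⟩
    have hp : 0 < L * (∫ ω, ‖η ω‖ ∂P) + 1 := by positivity
    rw [show L * (2 * (ε / (4 * (L * (∫ ω, ‖η ω‖ ∂P) + 1)))) * ∫ ω, ‖η ω‖ ∂P
      = (ε / 2) * ((L * ∫ ω, ‖η ω‖ ∂P) / (L * (∫ ω, ‖η ω‖ ∂P) + 1)) by field_simp; norm_num]
    have : (L * ∫ ω, ‖η ω‖ ∂P) / (L * (∫ ω, ‖η ω‖ ∂P) + 1) < 1 := by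
      rw [div_lt_one hp]; linarith
    nlinarith
  obtain ⟨d, hdD, hd⟩ := exists_seq_mem_Ioo hD R hδ
  have hmono : Monotone d := monotone_nat_of_le_succ fun j => by
    have h1 := (hd j).2
    have h2 := (hd (j + 1)).1
    push_cast at h2
    linarith
  have hstep (j : ℕ) : d (j + 1) - d j ≤ 2 * δ := by
    have h1 := (hd j).1
    have h2 := (hd (j + 1)).2
    push_cast at h2
    linarith
  obtain ⟨m, hm⟩ : ∃ m : ℕ, (R : ℝ) ≤ d m := by
    obtain ⟨m, hm⟩ := exists_nat_gt (2 * R / δ + 1)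
    refine ⟨m, ?_⟩
    have h1 := (hd m).1
    have : 2 * R < (m - 1) * δ := by
      rw [← div_lt_iff₀ hδ]; linarith
    linarith
  have h0 : d 0 ≤ -R := by simpa using (hd 0).2.le
  have hIoc {a b : ℝ} (ha : a ∈ D) (hb : b ∈ D) (hab : a ≤ b) :
      StablyConverges P X μ (Set.indicator (Set.Ioc a b) 1) := by
    convert (hDconv b hb).sub hX (hDconv a ha) using 2 with x
    by_cases h1 : x ≤ a
    · simp [h1, h1.trans hab, not_lt.2 h1]
    · by_cases h2 : x ≤ b <;> simp [h1, h2, not_le.1 h1]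
  -- Outside the partitioned interval the step function vanishes and `‖f‖ ≤ 1`, which accounts for
  -- the indicator in the error bound.
  refine ⟨fun x => ∑ j ∈ Finset.range m, f (d j) * Set.indicator (Set.Ioc (d j) (d (j + 1))) 1 x,
    fun x => Set.indicator (Set.Ioc (d 0) (d m))ᶜ 1 x + L * (2 * δ), ?_, ?_, ?_, ?_⟩
  · exact StablyConverges.sum hX (fun j => (hIoc (hdD _) (hdD _) (hmono j.le_succ)).const_mul _) m
  · have h1 := ((StablyConverges.const 1).sub hX (hIoc (hdD 0) (hdD m) (hmono m.zero_le))).add hX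
      (StablyConverges.const ((L * (2 * δ) : ℝ) : ℂ))
    convert h1 using 2 with x
    by_cases hx : x ∈ Set.Ioc (d 0) (d m) <;> simp [hx]
  · intro x
    have h1 := norm_indicator_sub_step_le hL hL0 hmono hstep m x
    by_cases hx : x ∈ Set.Ioc (d 0) (d m)
    · simpa [hx] using h1
    · have h2 : ‖f x - Set.indicator (Set.Ioc (d 0) (d m)) f x‖ ≤ 1 := by simpa [hx] using hf1 x
      have h3 : Set.indicator (Set.Ioc (d 0) (d m))ᶜ (1 : ℝ → ℝ) x = 1 := by
        rw [Set.indicator_of_mem (by simpa using hx)]; rfl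
      dsimp only
      rw [h3]
      exact (norm_sub_le_norm_sub_add_norm_sub _ _ _).trans (add_le_add h2 h1)
  · have hcompl (ω : Ω) : ∫ x, (Set.indicator (Set.Ioc (d 0) (d m))ᶜ 1 x + L * (2 * δ)) ∂(μ ω)
        = (μ ω).real (Set.Ioc (d 0) (d m))ᶜ + L * (2 * δ) := by
      rw [integral_add ((integrable_const 1).indicator measurableSet_Ioc.compl)
        (integrable_const _), integral_indicator_one measurableSet_Ioc.compl]
      simp
    have hint (a b : ℝ) : Integrable (fun ω => (μ ω).real (Set.Ioc a b)ᶜ * ‖η ω‖) P := by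
      refine hη.norm.bdd_mul (c := 1)
        (μ.measurable_coe measurableSet_Ioc.compl).ennreal_toReal.aestronglyMeasurable
        (ae_of_all _ fun ω => ?_)
      rw [Real.norm_of_nonneg measureReal_nonneg]
      exact measureReal_le_one
    simp_rw [hcompl, add_mul]
    rw [integral_add (hint _ _) (hη.norm.const_mul _), integral_const_mul]
    have : ∫ ω, (μ ω).real (Set.Ioc (d 0) (d m))ᶜ * ‖η ω‖ ∂P
        ≤ ∫ ω, (μ ω).real (Set.Ioc (-R : ℝ) R)ᶜ * ‖η ω‖ ∂P := by
      refine integral_mono (hint _ _) (hint _ _) fun ω => ?_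
      dsimp only
      gcongr
      · finiteness
    linarith

lemma norm_exp_mul_I_sub_le (u x y : ℝ) :
    ‖Complex.exp (u * x * Complex.I) - Complex.exp (u * y * Complex.I)‖ ≤ |u| * |x - y| := by
  have h1 : Complex.exp (u * x * Complex.I) - Complex.exp (u * y * Complex.I)
      = Complex.exp (((u * y : ℝ) : ℂ) * Complex.I)
        * (Complex.exp (Complex.I * ((u * (x - y) : ℝ) : ℂ)) - 1) := by
    rw [mul_sub, ← Complex.exp_add, mul_one]
    push_cast
    ring_nf
  rw [h1, norm_mul, Complex.norm_exp_ofReal_mul_I, one_mul]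
  simpa [abs_mul] using Real.norm_exp_I_mul_ofReal_sub_one_le (x := u * (x - y))

lemma norm_exp_mul_mul_I (u x : ℝ) : ‖Complex.exp (u * x * Complex.I)‖ = 1 := by
  simpa using Complex.norm_exp_ofReal_mul_I (u * x)

/-- The random variables `exp (i u X n)` converge stably to the random characteristic function. -/
lemma IsLimitRandomMeasure.stablyConverges_exp {P : Measure Ω} {X : ℕ → Ω → ℝ} {μ : Kernel Ω ℝ}
    (hX : ∀ n, Measurable (X n)) (hμ : IsLimitRandomMeasure P X μ) (u : ℝ) :
    StablyConverges P X μ (fun x => Complex.exp (u * x * Complex.I)) := by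
  obtain ⟨hM, ν, -, D, -, hD, hconv⟩ := hμ
  exact StablyConverges.of_lipschitz hX hD
    (fun t ht => WeakLinftyTendsto.stablyConverges hX (hconv t ht).2)
    (by fun_prop) (fun x => (norm_exp_mul_mul_I u x).le) (abs_nonneg u) (norm_exp_mul_I_sub_le u)

end

/-! ### Tightness and uniformity over compact parameter sets -/

section

variable {Ω : Type*} [MeasurableSpace Ω]

lemma measurable_charFun_kernel (μ : Kernel Ω ℝ) (t : ℝ) :
    Measurable (fun ω => charFun (μ ω) t) := by
  simp_rw [charFun_apply_real]
  exact (StronglyMeasurable.integral_kernel (κ := μ)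
    (f := fun x : ℝ => Complex.exp (t * x * Complex.I))
    (by fun_prop : Measurable _).stronglyMeasurable).measurable

variable {P : Measure Ω} {X : ℕ → Ω → ℝ} {μ : Kernel Ω ℝ}

lemma IsLimitRandomMeasure.tendsto_integral_exp_mul (hX : ∀ n, Measurable (X n))
    (hμ : IsLimitRandomMeasure P X μ) (u : ℝ) {η : Ω → ℂ} (hη : Integrable η P) :
    Tendsto (fun n => ∫ ω, Complex.exp (u * X n ω * Complex.I) * η ω ∂P) atTop
      (𝓝 (∫ ω, charFun (μ ω) u * η ω ∂P)) := by
  simp_rw [charFun_apply_real]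
  exact (hμ.stablyConverges_exp hX u).tendsto η hη

lemma charFun_map_eq_integral {Y : Ω → ℝ} (hY : Measurable Y) (t : ℝ) :
    charFun (P.map Y) t = ∫ ω, Complex.exp (t * Y ω * Complex.I) ∂P := by
  rw [charFun_apply_real, integral_map hY.aemeasurable]
  exact (by fun_prop : Measurable _).aestronglyMeasurable

/-- Testing against η = 1, the characteristic functions of `X n` converge to E[φ_ω(t)], which is
continuous at 0 by dominated convergence; Lévy's criterion applies. -/
lemma IsLimitRandomMeasure.isTightMeasureSet [IsProbabilityMeasure P]
    (hX : ∀ n, Measurable (X n))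
    (hμ : IsLimitRandomMeasure P X μ) :
    IsTightMeasureSet (Set.range fun n => P.map (X n)) := by
  have := hμ.1
  have (n : ℕ) : IsProbabilityMeasure (P.map (X n)) :=
    Measure.isProbabilityMeasure_map (hX n).aemeasurable
  refine isTightMeasureSet_of_tendsto_charFun (f := fun t => ∫ ω, charFun (μ ω) t ∂P) ?_ fun t => ?_
  · refine tendsto_integral_filter_of_dominated_convergence (fun _ => 1) ?_ ?_ (integrable_const _) ?_
    · exact Eventually.of_forall fun t => (measurable_charFun_kernel μ t).aestronglyMeasurable
    · exact Eventually.of_forall fun t => ae_of_all _ fun ω => norm_charFun_le_one t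
    · exact ae_of_all _ fun ω => continuous_charFun.continuousAt
  · simp_rw [charFun_map_eq_integral (hX _)]
    simpa using hμ.tendsto_integral_exp_mul hX t (integrable_const (1 : ℂ))

/-- Equicontinuity from tightness: the integrand is at most |h|R where |X_n| ≤ R and at most 2
elsewhere, with `R` independent of `n`. -/
lemma IsLimitRandomMeasure.tendsto_integral_norm_exp_sub_one [IsProbabilityMeasure P]
    (hX : ∀ n, Measurable (X n))
    (hμ : IsLimitRandomMeasure P X μ) :
    Tendsto (fun y : ℕ × ℝ => ∫ ω, ‖Complex.exp (y.2 * X y.1 ω * Complex.I) - 1‖ ∂P)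
      (atTop ×ˢ 𝓝 0) (𝓝 0) := by
  have htight := tendsto_measure_norm_gt_of_isTightMeasureSet (hμ.isTightMeasureSet hX)
  rw [Metric.tendsto_nhds]
  intro ε hε
  obtain ⟨R, hR, hR0⟩ := ((htight.eventually_lt_const
    (show (0 : ENNReal) < ENNReal.ofReal (ε / 4) by simpa using hε)).and
    (eventually_gt_atTop 0)).exists
  have hRn (n : ℕ) : P.real {ω | R < |X n ω|} ≤ ε / 4 := by
    have h1 : (P.map (X n)) {x | R < ‖x‖} ≤ ENNReal.ofReal (ε / 4) :=
      (le_iSup₂_of_le (f := fun (ν : Measure ℝ) (_ : ν ∈ Set.range fun n => P.map (X n)) =>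
        ν {x | R < ‖x‖}) _ ⟨n, rfl⟩ le_rfl).trans hR.le
    rw [Measure.map_apply (hX n) (measurableSet_lt measurable_const measurable_norm)] at h1
    exact ENNReal.toReal_le_of_le_ofReal (by positivity) h1
  have hsmall : ∀ᶠ h : ℝ in 𝓝 0, |h| * R < ε / 4 := by
    have : Tendsto (fun h : ℝ => |h| * R) (𝓝 0) (𝓝 (|0| * R)) :=
      (by fun_prop : Continuous fun h : ℝ => |h| * R).tendsto 0
    exact this.eventually_lt_const (by simpa using hε)
  filter_upwards [tendsto_snd.eventually hsmall] with y hy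
  rw [Real.dist_0_eq_abs, abs_of_nonneg (integral_nonneg fun _ => norm_nonneg _)]
  have hmeas : MeasurableSet {ω | R < |X y.1 ω|} :=
    measurableSet_lt measurable_const (hX _).norm
  have hint : Integrable (fun ω => |y.2| * R + 2 * Set.indicator {ω | R < |X y.1 ω|} 1 ω) P :=
    (integrable_const _).add (((integrable_const 1).indicator hmeas).const_mul 2)
  calc ∫ ω, ‖Complex.exp (y.2 * X y.1 ω * Complex.I) - 1‖ ∂P
      ≤ ∫ ω, (|y.2| * R + 2 * Set.indicator {ω | R < |X y.1 ω|} 1 ω) ∂P := by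
        refine integral_mono_of_nonneg (ae_of_all _ fun _ => norm_nonneg _) hint
          (ae_of_all _ fun ω => ?_)
        dsimp only
        by_cases hω : R < |X y.1 ω|
        · have h1 : Set.indicator {ω | R < |X y.1 ω|} (1 : Ω → ℝ) ω = 1 :=
            Set.indicator_of_mem (s := {ω | R < |X y.1 ω|}) hω _
          rw [h1]
          have h2 := norm_sub_le (Complex.exp (y.2 * X y.1 ω * Complex.I)) 1
          rw [norm_exp_mul_mul_I, norm_one] at h2
          have : 0 ≤ |y.2| * R := by positivity
          linarith
        · have h1 : Set.indicator {ω | R < |X y.1 ω|} (1 : Ω → ℝ) ω = 0 :=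
            Set.indicator_of_notMem (s := {ω | R < |X y.1 ω|}) hω _
          rw [h1]
          have h2 := norm_exp_mul_I_sub_le y.2 (X y.1 ω) 0
          have h3 : |y.2| * |X y.1 ω| ≤ |y.2| * R := by
            gcongr
            exact not_lt.1 hω
          simp only [Complex.ofReal_zero, mul_zero, zero_mul, Complex.exp_zero, sub_zero] at h2
          linarith
    _ = |y.2| * R + 2 * P.real {ω | R < |X y.1 ω|} := by
        rw [integral_add (integrable_const _) (((integrable_const 1).indicator hmeas).const_mul 2),
          MeasureTheory.integral_const, integral_const_mul (2 : ℝ), integral_indicator_one hmeas]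
        simp
    _ < ε := by linarith [hRn y.1]

lemma tendsto_integral_norm_sub [IsProbabilityMeasure P] {T : Type*} [TopologicalSpace T] [FirstCountableTopology T]
    {Y : T → Ω → ℂ} (hYm : ∀ t, Measurable (Y t)) (hYc : ∀ ω, Continuous fun t => Y t ω)
    (hY : ∀ t ω, ‖Y t ω‖ ≤ 1) (t₀ : T) :
    Tendsto (fun t => ∫ ω, ‖Y t ω - Y t₀ ω‖ ∂P) (𝓝 t₀) (𝓝 0) := by
  have h := tendsto_integral_filter_of_dominated_convergence (μ := P) (l := 𝓝 t₀)
    (F := fun t ω => ‖Y t ω - Y t₀ ω‖) (f := fun _ => 0) (fun _ => 2) ?_ ?_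
    (integrable_const _) ?_
  · simpa using h
  · exact Eventually.of_forall fun t => ((hYm t).sub (hYm t₀)).norm.aestronglyMeasurable
  · refine Eventually.of_forall fun t => ae_of_all _ fun ω => ?_
    rw [norm_norm]
    exact (norm_sub_le _ _).trans (by linarith [hY t ω, hY t₀ ω])
  · refine ae_of_all _ fun ω => ?_
    simpa using (((hYc ω).tendsto t₀).sub_const (Y t₀ ω)).norm

lemma norm_integral_mul_exp_sub_le [IsProbabilityMeasure P] {Z : Ω → ℝ} (hZ : Measurable Z) {Y Y' : Ω → ℂ}
    (hYm : Measurable Y) (hYm' : Measurable Y') (hY : ∀ ω, ‖Y ω‖ ≤ 1) (hY' : ∀ ω, ‖Y' ω‖ ≤ 1)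
    (v v' : ℝ) :
    ‖(∫ ω, Y ω * Complex.exp (v * Z ω * Complex.I) ∂P)
      - ∫ ω, Y' ω * Complex.exp (v' * Z ω * Complex.I) ∂P‖
      ≤ (∫ ω, ‖Y ω - Y' ω‖ ∂P)
        + ∫ ω, ‖Complex.exp (((v - v' : ℝ) : ℂ) * Z ω * Complex.I) - 1‖ ∂P := by
  have hE (v : ℝ) : Measurable fun ω => Complex.exp (v * Z ω * Complex.I) := by fun_prop
  have hint {U : Ω → ℂ} (hU : Measurable U) (hU1 : ∀ ω, ‖U ω‖ ≤ 1) (v : ℝ) :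
      Integrable (fun ω => U ω * Complex.exp (v * Z ω * Complex.I)) P := by
    refine Integrable.of_bound (C := 1) (hU.mul (hE v)).aestronglyMeasurable
      (ae_of_all _ fun ω => ?_)
    rw [norm_mul, norm_exp_mul_mul_I, mul_one]
    exact hU1 ω
  rw [← integral_sub (hint hYm hY v) (hint hYm' hY' v')]
  have hi1 : Integrable (fun ω => ‖Y ω - Y' ω‖) P := by
    refine Integrable.of_bound (C := 2) (hYm.sub hYm').norm.aestronglyMeasurable
      (ae_of_all _ fun ω => ?_)
    rw [norm_norm]
    exact (norm_sub_le _ _).trans (by linarith [hY ω, hY' ω])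
  have hi2 : Integrable (fun ω =>
      ‖Complex.exp (((v - v' : ℝ) : ℂ) * Z ω * Complex.I) - 1‖) P := by
    refine Integrable.of_bound (C := 2) ((hE _).sub_const 1).norm.aestronglyMeasurable
      (ae_of_all _ fun ω => ?_)
    rw [norm_norm]
    refine (norm_sub_le _ _).trans ?_
    rw [norm_exp_mul_mul_I, norm_one]
    norm_num
  rw [← integral_add hi1 hi2]
  refine norm_integral_le_of_norm_le (hi1.add hi2) (ae_of_all _ fun ω => ?_)
  have hexp : Complex.exp (v * Z ω * Complex.I) = Complex.exp (v' * Z ω * Complex.I)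
      * Complex.exp (((v - v' : ℝ) : ℂ) * Z ω * Complex.I) := by
    rw [← Complex.exp_add]
    push_cast
    ring_nf
  have hsplit : Y ω * Complex.exp (v * Z ω * Complex.I) - Y' ω * Complex.exp (v' * Z ω * Complex.I)
      = (Y ω - Y' ω) * Complex.exp (v * Z ω * Complex.I)
        + Y' ω * Complex.exp (v' * Z ω * Complex.I)
          * (Complex.exp (((v - v' : ℝ) : ℂ) * Z ω * Complex.I) - 1) := by
    linear_combination Y' ω * hexp
  rw [hsplit]
  refine (norm_add_le _ _).trans (add_le_add ?_ ?_)
  · rw [norm_mul, norm_exp_mul_mul_I, mul_one]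
  · rw [norm_mul, norm_mul, norm_exp_mul_mul_I, mul_one]
    exact mul_le_of_le_one_left (norm_nonneg _) (hY' _)

/-- The limit is joint in (n, t), which is what local uniformity requires. Freezing the parameter at
`t₀` costs the L¹ distance of the `Y`'s plus the equicontinuity term; at `t₀` stable convergence
applies. -/
lemma IsLimitRandomMeasure.tendsto_integral_mul_exp_sub_charFun [IsProbabilityMeasure P]
    (hX : ∀ n, Measurable (X n))
    (hμ : IsLimitRandomMeasure P X μ) {T : Type*} [TopologicalSpace T] [FirstCountableTopology T]
    {Y : T → Ω → ℂ} (hYm : ∀ t, Measurable (Y t))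
    (hYc : ∀ ω, Continuous fun t => Y t ω) (hY : ∀ t ω, ‖Y t ω‖ ≤ 1) {u : T → ℝ}
    (hu : Continuous u) (t₀ : T) :
    Tendsto (fun y : ℕ × T => ∫ ω, Y y.2 ω *
        (Complex.exp (u y.2 * X y.1 ω * Complex.I) - charFun (μ ω) (u y.2)) ∂P)
      (atTop ×ˢ 𝓝 t₀) (𝓝 0) := by
  have := hμ.1
  have hYint (t : T) : Integrable (Y t) P :=
    Integrable.of_bound (hYm t).aestronglyMeasurable 1 (ae_of_all _ (hY t))
  have hE (n : ℕ) (v : ℝ) : Measurable fun ω => Complex.exp (v * X n ω * Complex.I) := by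
    have := hX n
    fun_prop
  have hYE (t : T) (n : ℕ) (v : ℝ) :
      Integrable (fun ω => Y t ω * Complex.exp (v * X n ω * Complex.I)) P :=
    (hYint t).mul_bdd (c := 1) (hE n v).aestronglyMeasurable
      (ae_of_all _ fun ω => (norm_exp_mul_mul_I _ _).le)
  have hYφ (t : T) (v : ℝ) : Integrable (fun ω => Y t ω * charFun (μ ω) v) P :=
    (hYint t).mul_bdd (c := 1) (measurable_charFun_kernel μ v).aestronglyMeasurable
      (ae_of_all _ fun ω => norm_charFun_le_one v)
  have hfix := ((hμ.tendsto_integral_exp_mul hX (u t₀) (hYint t₀)).comp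
    (tendsto_fst (f := atTop) (g := 𝓝 t₀)))
  have hφ : Tendsto (fun t => ∫ ω, Y t ω * charFun (μ ω) (u t) ∂P)
      (𝓝 t₀) (𝓝 (∫ ω, Y t₀ ω * charFun (μ ω) (u t₀) ∂P)) := by
    refine tendsto_integral_filter_of_dominated_convergence (fun _ => 1) ?_ ?_
      (integrable_const _) ?_
    · exact Eventually.of_forall fun t => (hYφ t _).aestronglyMeasurable
    · refine Eventually.of_forall fun t => ae_of_all _ fun ω => ?_
      rw [norm_mul]
      exact mul_le_one₀ (hY t ω) (norm_nonneg _) (norm_charFun_le_one _)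
    · exact ae_of_all _ fun ω => ((hYc ω).mul (continuous_charFun.comp hu)).tendsto t₀
  have hφ' := hφ.comp (tendsto_snd (f := (atTop : Filter ℕ)) (g := 𝓝 t₀))
  have hYdiff := (tendsto_integral_norm_sub (P := P) hYm hYc hY t₀).comp
    (tendsto_snd (f := (atTop : Filter ℕ)) (g := 𝓝 t₀))
  have hprod : Tendsto (fun y : ℕ × T => (y.1, u y.2 - u t₀)) (atTop ×ˢ 𝓝 t₀)
      (atTop ×ˢ 𝓝 0) := by
    have h1 : Tendsto (fun t => u t - u t₀) (𝓝 t₀) (𝓝 0) := by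
      simpa using (hu.tendsto t₀).sub_const (u t₀)
    exact tendsto_fst.prodMk (h1.comp tendsto_snd)
  have hudiff := (hμ.tendsto_integral_norm_exp_sub_one hX).comp hprod
  have hbound := hYdiff.add hudiff
  rw [add_zero] at hbound
  have hdiff : Tendsto (fun y : ℕ × T =>
      (∫ ω, Y y.2 ω * Complex.exp (u y.2 * X y.1 ω * Complex.I) ∂P)
        - ∫ ω, Y t₀ ω * Complex.exp (u t₀ * X y.1 ω * Complex.I) ∂P) (atTop ×ˢ 𝓝 t₀) (𝓝 0) :=
    squeeze_zero_norm (fun y => norm_integral_mul_exp_sub_le (hX y.1) (hYm _) (hYm _) (hY _) (hY _)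
      (u y.2) (u t₀)) hbound
  have hall := (hdiff.add hfix).sub hφ'
  have hlim : 0 + ∫ ω, charFun (μ ω) (u t₀) * Y t₀ ω ∂P
      - ∫ ω, Y t₀ ω * charFun (μ ω) (u t₀) ∂P = 0 := by
    simp_rw [mul_comm (Y t₀ _)]
    ring
  rw [hlim] at hall
  refine hall.congr fun y => ?_
  simp only [Function.comp_apply]
  simp_rw [mul_comm _ (Y t₀ _)]
  rw [sub_add_cancel, ← integral_sub (hYE _ _ _) (hYφ _ _)]
  simp_rw [mul_sub]

/-- The convergence `E[Y exp (i u X n)] → E[Y φ(u)]`, `φ` the random characteristic function, is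
uniform when `Y` and `u` depend continuously on a parameter in a compact set. -/
lemma IsLimitRandomMeasure.eventually_norm_integral_lt [IsProbabilityMeasure P]
    (hX : ∀ n, Measurable (X n))
    (hμ : IsLimitRandomMeasure P X μ) {T : Type*} [TopologicalSpace T] [FirstCountableTopology T]
    {K : Set T} (hK : IsCompact K) {Y : T → Ω → ℂ} (hYm : ∀ t, Measurable (Y t))
    (hYc : ∀ ω, Continuous fun t => Y t ω) (hY : ∀ t ω, ‖Y t ω‖ ≤ 1) {u : T → ℝ}
    (hu : Continuous u) {ε : ℝ} (hε : 0 < ε) :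
    ∀ᶠ n in atTop, ∀ t ∈ K,
      ‖∫ ω, Y t ω * (Complex.exp (u t * X n ω * Complex.I) - charFun (μ ω) (u t)) ∂P‖ < ε := by
  -- On a compact set, uniform convergence is locally uniform convergence, hence a joint limit at
  -- each point.
  have hunif : TendstoUniformlyOn (fun n t => ∫ ω, Y t ω *
      (Complex.exp (u t * X n ω * Complex.I) - charFun (μ ω) (u t)) ∂P) 0 atTop K := by
    rw [← tendstoLocallyUniformlyOn_iff_tendstoUniformlyOn_of_compact hK,
      tendstoLocallyUniformlyOn_iff_forall_tendsto]
    intro t₀ _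
    refine Tendsto.mono_left ?_ (prod_mono_right atTop nhdsWithin_le_nhds)
    rw [tendsto_uniformity_iff_dist_tendsto_zero]
    simpa [dist_zero_left] using
      (hμ.tendsto_integral_mul_exp_sub_charFun hX hYm hYc hY hu t₀).norm
  filter_upwards [Metric.tendstoUniformlyOn_iff.1 hunif ε hε] with n hn t ht
  simpa [dist_zero_left] using hn t ht

end

/-! ### The stable characteristic function and truncation of the random measure -/

section

variable {Ω : Type*} [MeasurableSpace Ω]

/-- The characteristic function `exp (-c |t|^α)` of the symmetric stable law. -/
def stableCharFun (α c t : ℝ) : ℝ := Real.exp (-c * |t| ^ α)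

lemma stableCharFun_zero {α : ℝ} (hα : 0 < α) (c : ℝ) : stableCharFun α c 0 = 1 := by
  simp [stableCharFun, Real.zero_rpow hα.ne']

lemma stableCharFun_pos (α c t : ℝ) : 0 < stableCharFun α c t := Real.exp_pos _

lemma stableCharFun_le_one {c : ℝ} (hc : 0 ≤ c) (α t : ℝ) : stableCharFun α c t ≤ 1 := by
  rw [stableCharFun, Real.exp_le_one_iff]
  have : 0 ≤ |t| ^ α := by positivity
  nlinarith

lemma norm_stableCharFun_le_one {c : ℝ} (hc : 0 ≤ c) (α t : ℝ) :
    ‖(stableCharFun α c t : ℂ)‖ ≤ 1 := by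
  rw [Complex.norm_real, Real.norm_of_nonneg (stableCharFun_pos _ _ _).le]
  exact stableCharFun_le_one hc α t

lemma continuous_abs_rpow {α : ℝ} (hα : 0 < α) : Continuous fun t : ℝ => |t| ^ α :=
  continuous_abs.rpow_const fun _ => Or.inr hα.le

lemma continuous_stableCharFun {α : ℝ} (hα : 0 < α) (c : ℝ) : Continuous (stableCharFun α c) :=
  Real.continuous_exp.comp (continuous_const.mul (continuous_abs_rpow hα))

lemma stableCharFun_sub_isLittleO {α : ℝ} (hα : 0 < α) (c : ℝ) :
    (fun t : ℝ => stableCharFun α c t - (1 - c * |t| ^ α)) =o[𝓝 0] (fun t : ℝ => |t| ^ α) := by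
  have hexp : (fun x : ℝ => Real.exp x - 1 - x) =o[𝓝 0] (fun x : ℝ => x) := by
    simpa using (hasDerivAt_iff_isLittleO.1 (Real.hasDerivAt_exp 0))
  have hlim : Tendsto (fun t : ℝ => -c * |t| ^ α) (𝓝 0) (𝓝 0) := by
    have := (continuous_const.mul (continuous_abs_rpow hα)).tendsto (x := 0)
      (f := fun t : ℝ => -c * |t| ^ α)
    simpa [Real.zero_rpow hα.ne'] using this
  have h := (hexp.comp_tendsto hlim).trans_isBigO
    (isBigO_const_mul_self (-c) (fun t : ℝ => |t| ^ α) (𝓝 0))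
  refine h.congr_left fun t => ?_
  simp only [Function.comp_apply, stableCharFun]
  ring

lemma charFun_sub_stableCharFun_isLittleO {α c : ℝ} (hα : 0 < α) {ν : Measure ℝ}
    (hν : ν ∈ stableClass α c) :
    (fun t : ℝ => charFun ν t - (stableCharFun α c t : ℂ)) =o[𝓝 0] (fun t : ℝ => |t| ^ α) := by
  have h1 : (fun t : ℝ => ((stableCharFun α c t - (1 - c * |t| ^ α) : ℝ) : ℂ)) =o[𝓝 0]
      (fun t : ℝ => |t| ^ α) := by
    refine IsLittleO.of_norm_left ?_
    simp_rw [Complex.norm_real]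
    exact (stableCharFun_sub_isLittleO hα c).norm_left
  refine (hν.2.2.sub h1).congr_left fun t => ?_
  push_cast
  ring

/-- The event that `|φ(q) - exp (-c |q|^α)| ≤ M |q|^α` for all rational `q`, where `φ` is the
characteristic function of the random measure. -/
def truncSet (μ : Kernel Ω ℝ) (α c : ℝ) (M : ℕ) : Set Ω :=
  {ω | ∀ q : ℚ, ‖charFun (μ ω) (q : ℝ) - (stableCharFun α c q : ℂ)‖ ≤ M * |(q : ℝ)| ^ α}

variable {μ : Kernel Ω ℝ} {α c : ℝ}

lemma measurableSet_truncSet (M : ℕ) : MeasurableSet (truncSet μ α c M) := by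
  simp only [truncSet, Set.ofPred_forall]
  exact MeasurableSet.iInter fun q => measurableSet_le
    ((measurable_charFun_kernel μ q).sub_const _).norm measurable_const

/-- Quantifying over rationals keeps the event measurable; continuity of both sides recovers all
real `t`. -/
lemma norm_charFun_sub_le_of_mem_truncSet [IsMarkovKernel μ] (hα : 0 < α) {M : ℕ} {ω : Ω}
    (hω : ω ∈ truncSet μ α c M) (t : ℝ) :
    ‖charFun (μ ω) t - (stableCharFun α c t : ℂ)‖ ≤ M * |t| ^ α := by
  have hclosed : IsClosed {t : ℝ | ‖charFun (μ ω) t - (stableCharFun α c t : ℂ)‖ ≤ M * |t| ^ α} :=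
    isClosed_le (continuous_charFun.sub
      (Complex.continuous_ofReal.comp (continuous_stableCharFun hα c))).norm
      (continuous_const.mul (continuous_abs_rpow hα))
  exact Rat.denseRange_cast.induction_on (p := fun t : ℝ =>
    ‖charFun (μ ω) t - (stableCharFun α c t : ℂ)‖ ≤ M * |t| ^ α) t hclosed hω

lemma monotone_truncSet : Monotone (truncSet μ α c) := by
  intro M N hMN ω hω q
  refine (hω q).trans ?_
  gcongr

/-- Near 0 the little-o bound holds with constant 1; for |q| ≥ δ the trivial bound 2 is at most
(2/δ^α)|q|^α. -/
lemma exists_mem_truncSet [IsMarkovKernel μ] (hα : 0 < α) (hc : 0 ≤ c) {ω : Ω}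
    (hω : μ ω ∈ stableClass α c) : ∃ M, ω ∈ truncSet μ α c M := by
  have h := (charFun_sub_stableCharFun_isLittleO hα hω).def one_pos
  obtain ⟨δ, hδ, hball⟩ := Metric.eventually_nhds_iff.1 h
  obtain ⟨M, hM⟩ := exists_nat_ge (max 1 (2 / δ ^ α))
  refine ⟨M, fun q => ?_⟩
  have hpow : 0 ≤ |(q : ℝ)| ^ α := by positivity
  by_cases hq : |(q : ℝ)| < δ
  · have h1 := hball (y := (q : ℝ)) (by rw [Real.dist_0_eq_abs]; exact hq)
    rw [Real.norm_of_nonneg hpow] at h1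
    refine h1.trans ?_
    gcongr
    exact (le_max_left _ _).trans hM
  · have h1 : ‖charFun (μ ω) (q : ℝ) - (stableCharFun α c q : ℂ)‖ ≤ 2 :=
      (norm_sub_le _ _).trans (by
        linarith [norm_charFun_le_one (μ := μ ω) (q : ℝ), norm_stableCharFun_le_one hc α q])
    have h2 : δ ^ α ≤ |(q : ℝ)| ^ α := Real.rpow_le_rpow hδ.le (not_lt.1 hq) hα.le
    have hδα : 0 < δ ^ α := Real.rpow_pos_of_pos hδ α
    calc _ ≤ 2 := h1
      _ = 2 / δ ^ α * δ ^ α := by field_simp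
      _ ≤ M * |(q : ℝ)| ^ α := by
        gcongr
        exact (le_max_right _ _).trans hM

lemma tendsto_measureReal_compl_truncSet [IsMarkovKernel μ] {P : Measure Ω} [IsFiniteMeasure P]
    (hα : 0 < α) (hc : 0 ≤ c) (hμS : ∀ᵐ ω ∂P, μ ω ∈ stableClass α c) :
    Tendsto (fun M => P.real (truncSet μ α c M)ᶜ) atTop (𝓝 0) := by
  have key := tendsto_measure_iInter_atTop (μ := P) (s := fun M => (truncSet μ α c M)ᶜ)
    (fun M => (measurableSet_truncSet M).compl.nullMeasurableSet)
    (fun M N h => Set.compl_subset_compl.2 (monotone_truncSet h)) ⟨0, measure_ne_top _ _⟩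
  have hnull : P (⋂ M, (truncSet μ α c M)ᶜ) = 0 := by
    refine measure_mono_null ?_ (ae_iff.1 hμS)
    intro ω hω
    rw [Set.mem_ofPred_eq]
    intro h
    obtain ⟨M, hM⟩ := exists_mem_truncSet hα hc h
    exact Set.mem_iInter.1 hω M hM
  rw [hnull] at key
  simpa [Measure.real, Function.comp_def] using (ENNReal.tendsto_toReal ENNReal.zero_ne_top).comp key

/-- Truncation supplies the dominating constant `M` for the quotient, so the pointwise little-o
passes to the integral. -/
lemma integral_truncSet_isLittleO [IsMarkovKernel μ] {P : Measure Ω} [IsFiniteMeasure P]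
    (hα : 0 < α) (hμS : ∀ᵐ ω ∂P, μ ω ∈ stableClass α c) (M : ℕ) :
    (fun t : ℝ => ∫ ω in truncSet μ α c M, ‖charFun (μ ω) t - (stableCharFun α c t : ℂ)‖ ∂P)
      =o[𝓝 0] (fun t : ℝ => |t| ^ α) := by
  rw [isLittleO_iff_tendsto]
  · simp_rw [← integral_div]
    have h := tendsto_integral_filter_of_dominated_convergence
      (μ := P.restrict (truncSet μ α c M)) (l := 𝓝 (0 : ℝ))
      (F := fun t ω => ‖charFun (μ ω) t - (stableCharFun α c t : ℂ)‖ / |t| ^ α) (f := fun _ => 0)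
      (fun _ => M) ?_ ?_ (integrable_const _) ?_
    · simpa using h
    · exact Eventually.of_forall fun t => (((measurable_charFun_kernel μ t).sub_const
        _).norm.div_const _).aestronglyMeasurable
    · refine Eventually.of_forall fun t => ?_
      filter_upwards [ae_restrict_mem (measurableSet_truncSet M)] with ω hω
      rw [Real.norm_of_nonneg (by positivity)]
      exact div_le_of_le_mul₀ (by positivity) (by positivity)
        (norm_charFun_sub_le_of_mem_truncSet hα hω t)
    · filter_upwards [ae_restrict_of_ae hμS] with ω hω
      exact (charFun_sub_stableCharFun_isLittleO hα hω).norm_left.tendsto_div_nhds_zero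
  · intro t ht
    have ht0 : t = 0 := by
      by_contra hne
      exact (Real.rpow_pos_of_pos (abs_pos.2 hne) α).ne' ht
    simp [ht0, stableCharFun_zero hα]

end

/-! ### Selection of the subsequence and replacement of factors -/

section

variable {Ω : Type*}

lemma exists_strictMono_of_eventually {Q : ℕ → (ℕ → ℕ) → ℕ → Prop}
    (hQ : ∀ k f, ∀ᶠ m in atTop, Q k f m)
    (hcongr : ∀ k f g m, (∀ j < k, f j = g j) → Q k f m → Q k g m) :
    ∃ n : ℕ → ℕ, StrictMono n ∧ ∀ k, Q k n (n k) := by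
  have hex (k : ℕ) (f : ℕ → ℕ) : ∃ m, Q k f m ∧ ∀ j < k, f j < m := by
    refine ((hQ k f).and ?_).exists
    exact (Set.finite_lt_nat k).eventually_all.2 fun j _ => eventually_gt_atTop (f j)
  choose F hFQ hFlt using hex
  let step : (k : ℕ) → ((j : ℕ) → j < k → ℕ) → ℕ :=
    -- The padding value 0 is harmless: by `hcongr` the condition at stage `k` sees only indices
    -- below `k`.
    fun k ih => F k fun j => if h : j < k then ih j h else 0
  let n : ℕ → ℕ := Nat.lt_wfRel.wf.fix step
  have hn (k : ℕ) : n k = F k fun j => if j < k then n j else 0 := by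
    have := Nat.lt_wfRel.wf.fix_eq step k
    simpa [step, n] using this
  refine ⟨n, strictMono_nat_of_lt_succ fun k => ?_, fun k => ?_⟩
  · have h := hFlt (k + 1) (fun j => if j < k + 1 then n j else 0) k k.lt_succ_self
    rw [← hn] at h
    simpa using h
  · have h := hFQ k fun j => if j < k then n j else 0
    rw [← hn] at h
    exact hcongr k _ _ _ (fun j hj => by simp [hj]) h

/-- The product of `exp (i t_j X_{n_j})` over `M ≤ j < k`. -/
def expProd (X : ℕ → Ω → ℝ) (n : ℕ → ℕ) (M k : ℕ) (t : ℕ → ℝ) (ω : Ω) : ℂ :=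
  ∏ j ∈ Finset.Ico M k, Complex.exp (t j * X (n j) ω * Complex.I)

lemma norm_expProd (X : ℕ → Ω → ℝ) (n : ℕ → ℕ) (M k : ℕ) (t : ℕ → ℝ) (ω : Ω) :
    ‖expProd X n M k t ω‖ = 1 := by
  simp only [expProd, norm_prod, norm_exp_mul_mul_I, Finset.prod_const_one]

lemma continuous_expProd (X : ℕ → Ω → ℝ) (n : ℕ → ℕ) (M k : ℕ) (ω : Ω) :
    Continuous fun t => expProd X n M k t ω := by
  unfold expProd
  fun_prop

lemma norm_indicator_expProd_le (X : ℕ → Ω → ℝ) (A : Set Ω) (n : ℕ → ℕ) (M k : ℕ) (t : ℕ → ℝ) (ω : Ω) :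
    ‖A.indicator (expProd X n M k t) ω‖ ≤ 1 := by
  rw [norm_indicator_eq_indicator_norm]
  simp only [norm_expProd]
  exact Set.indicator_le_self' (fun _ _ => zero_le_one) ω

variable [MeasurableSpace Ω] {P : Measure Ω} {X : ℕ → Ω → ℝ} {μ : Kernel Ω ℝ} {α c : ℝ}

lemma measurable_expProd (hX : ∀ n, Measurable (X n)) (n : ℕ → ℕ) (M k : ℕ) (t : ℕ → ℝ) :
    Measurable (expProd X n M k t) := by
  unfold expProd
  fun_prop

/-- The choice of the subsequence: given the previous terms, `X_{n_k}` behaves as if it were drawn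
from the random measure, up to an error `2^{-k}`. -/
def IsAlmostExchangeable (P : Measure Ω) (X : ℕ → Ω → ℝ) (μ : Kernel Ω ℝ) (A : ℕ → Set Ω)
    (n : ℕ → ℕ) : Prop :=
  ∀ k, ∀ M ≤ k, ∀ t : ℕ → ℝ, (∀ j, |t j| ≤ 1) →
    ‖∫ ω, (A M).indicator (expProd X n M k t) ω
      * (Complex.exp (t k * X (n k) ω * Complex.I) - charFun (μ ω) (t k)) ∂P‖ ≤ (1 / 2) ^ k

lemma IsLimitRandomMeasure.exists_isAlmostExchangeable [IsProbabilityMeasure P]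
    (hX : ∀ n, Measurable (X n)) (hμ : IsLimitRandomMeasure P X μ) {A : ℕ → Set Ω}
    (hA : ∀ M, MeasurableSet (A M)) :
    ∃ n : ℕ → ℕ, StrictMono n ∧ IsAlmostExchangeable P X μ A n := by
  refine exists_strictMono_of_eventually
    (Q := fun k n m => ∀ M ≤ k, ∀ t : ℕ → ℝ, (∀ j, |t j| ≤ 1) →
      ‖∫ ω, (A M).indicator (expProd X n M k t) ω
        * (Complex.exp (t k * X m ω * Complex.I) - charFun (μ ω) (t k)) ∂P‖ ≤ (1 / 2) ^ k)
    (fun k n => ?_) (fun k f g m hfg h M hM t ht => ?_)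
  -- Only finitely many events `A M` enter at stage `k`, and the cube of coefficients is compact by
  -- Tychonoff.
  · refine (Set.finite_le_nat k).eventually_all.2 fun M _ => ?_
    have hK : IsCompact (Set.univ.pi fun _ : ℕ => Set.Icc (-1 : ℝ) 1) :=
      isCompact_univ_pi fun _ => isCompact_Icc
    have hcont (ω : Ω) : Continuous fun t => (A M).indicator (expProd X n M k t) ω := by
      by_cases hω : ω ∈ A M
      · simpa [hω] using continuous_expProd X n M k ω
      · simpa [hω] using continuous_const
    filter_upwards [hμ.eventually_norm_integral_lt hX hK
      (Y := fun t => (A M).indicator (expProd X n M k t)) (u := fun t => t k)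
      (fun t => (measurable_expProd hX n M k t).indicator (hA M)) hcont
      (fun t ω => norm_indicator_expProd_le _ _ _ _ _ _ _) (continuous_apply k)
      (show (0 : ℝ) < (1 / 2) ^ k by positivity)] with m hm t ht
    exact (hm t fun j _ => abs_le.1 (ht j)).le
  · have : expProd X g M k t = expProd X f M k t := by
      ext ω
      exact Finset.prod_congr rfl fun j hj => by rw [hfg j (Finset.mem_Ico.1 hj).2]
    rw [this]
    exact h M hM t ht

/-- Peel off the last factor: write e = (e - φ) + (φ - g) + g. The first difference is controlled by
the selection, the second by its integral over `A M`, and the deterministic g, of modulus at most 1,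
leaves the induction hypothesis. -/
lemma IsAlmostExchangeable.norm_integral_sub_le [IsProbabilityMeasure P] [IsMarkovKernel μ]
    (hX : ∀ n, Measurable (X n)) (hc : 0 ≤ c) {A : ℕ → Set Ω} (hA : ∀ M, MeasurableSet (A M))
    {n : ℕ → ℕ} (hn : IsAlmostExchangeable P X μ A n) {t : ℕ → ℝ} (ht : ∀ j, |t j| ≤ 1)
    {M N : ℕ} (hMN : M ≤ N) :
    ‖(∫ ω, (A M).indicator (expProd X n M N t) ω ∂P)
      - P.real (A M) * ∏ j ∈ Finset.Ico M N, (stableCharFun α c (t j) : ℂ)‖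
      ≤ ∑ k ∈ Finset.Ico M N, ((1 / 2) ^ k
        + ∫ ω in A M, ‖charFun (μ ω) (t k) - (stableCharFun α c (t k) : ℂ)‖ ∂P) := by
  induction N, hMN using Nat.le_induction with
  | base =>
    have : expProd X n M M t = fun _ => 1 := by ext ω; simp [expProd]
    simp [this, integral_indicator (hA M)]
  | succ N hMN ih =>
    set Y := (A M).indicator (expProd X n M N t) with hY
    have hYm : Measurable Y := (measurable_expProd hX n M N t).indicator (hA M)
    have hYint : Integrable Y P := Integrable.of_bound hYm.aestronglyMeasurable 1
      (ae_of_all _ fun ω => norm_indicator_expProd_le _ _ _ _ _ _ _)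
    set g : ℂ := (stableCharFun α c (t N) : ℂ) with hg
    have hE : Measurable fun ω => Complex.exp (t N * X (n N) ω * Complex.I) := by fun_prop
    have hφ := measurable_charFun_kernel μ (t N)
    have hi1 : Integrable (fun ω => Y ω
        * (Complex.exp (t N * X (n N) ω * Complex.I) - charFun (μ ω) (t N))) P :=
      hYint.mul_bdd (c := 2) (hE.sub hφ).aestronglyMeasurable (ae_of_all _ fun ω =>
        (norm_sub_le _ _).trans (by
          linarith [norm_charFun_le_one (μ := μ ω) (t N), norm_exp_mul_mul_I (t N) (X (n N) ω)]))
    have hdiff : ∀ ω, ‖charFun (μ ω) (t N) - g‖ ≤ 2 := fun ω =>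
        (norm_sub_le _ _).trans (by
          linarith [norm_charFun_le_one (μ := μ ω) (t N), norm_stableCharFun_le_one hc α (t N)])
    have hi2 : Integrable (fun ω => Y ω * (charFun (μ ω) (t N) - g)) P :=
      hYint.mul_bdd (c := 2) (hφ.sub_const g).aestronglyMeasurable (ae_of_all _ hdiff)
    have hi12 : Integrable (fun ω => Y ω
        * (Complex.exp (t N * X (n N) ω * Complex.I) - charFun (μ ω) (t N))
        + Y ω * (charFun (μ ω) (t N) - g)) P := hi1.add hi2
    have hsplit : ∫ ω, (A M).indicator (expProd X n M (N + 1) t) ω ∂P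
        = (∫ ω, Y ω * (Complex.exp (t N * X (n N) ω * Complex.I) - charFun (μ ω) (t N)) ∂P)
          + (∫ ω, Y ω * (charFun (μ ω) (t N) - g) ∂P) + (∫ ω, Y ω ∂P) * g := by
      rw [← integral_mul_const, ← integral_add hi1 hi2,
        ← integral_add hi12 (hYint.mul_const g)]
      congr 1
      ext ω
      have : (A M).indicator (expProd X n M (N + 1) t) ω
          = Y ω * Complex.exp (t N * X (n N) ω * Complex.I) := by
        by_cases hω : ω ∈ A M
        · simp [hY, hω, expProd, Finset.prod_Ico_succ_top hMN]
        · simp [hY, hω]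
      rw [this]
      ring
    have hb2 : ‖∫ ω, Y ω * (charFun (μ ω) (t N) - g) ∂P‖
        ≤ ∫ ω in A M, ‖charFun (μ ω) (t N) - g‖ ∂P := by
      rw [← integral_indicator (hA M)]
      refine norm_integral_le_of_norm_le ?_ (ae_of_all _ fun ω => ?_)
      · exact (Integrable.of_bound (C := 2) (hφ.sub_const g).norm.aestronglyMeasurable
          (ae_of_all _ fun ω => by rw [norm_norm]; exact hdiff ω)).indicator (hA M)
      · by_cases hω : ω ∈ A M
        · simp [hY, hω, norm_expProd]
        · simp [hY, hω]
    rw [hsplit, Finset.prod_Ico_succ_top hMN, Finset.sum_Ico_succ_top hMN]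
    have hb1 := hn N M hMN t ht
    calc _ = ‖(∫ ω, Y ω * (Complex.exp (t N * X (n N) ω * Complex.I) - charFun (μ ω) (t N)) ∂P)
          + (∫ ω, Y ω * (charFun (μ ω) (t N) - g) ∂P)
          + ((∫ ω, Y ω ∂P) - P.real (A M) * ∏ j ∈ Finset.Ico M N, (stableCharFun α c (t j) : ℂ))
            * g‖ := by
          congr 1
          ring
      _ ≤ _ + _ + _ := norm_add₃_le
      _ ≤ (1 / 2) ^ N + (∫ ω in A M, ‖charFun (μ ω) (t N) - g‖ ∂P)
          + ‖(∫ ω, Y ω ∂P) - P.real (A M) * ∏ j ∈ Finset.Ico M N, (stableCharFun α c (t j) : ℂ)‖ := by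
          gcongr
          rw [norm_mul]
          exact mul_le_of_le_one_right (norm_nonneg _) (norm_stableCharFun_le_one hc α (t N))
      _ ≤ _ := by linarith

end

/-! ### Triangular arrays, normalized weights and the limit law -/

section

variable {Ω : Type*} [MeasurableSpace Ω] {P : Measure Ω} {X : ℕ → Ω → ℝ} {μ : Kernel Ω ℝ} {α c : ℝ}

lemma norm_integral_expProd_sub_le [IsProbabilityMeasure P] (hX : ∀ n, Measurable (X n))
    {A : Set Ω} (hA : MeasurableSet A) (n : ℕ → ℕ) (t : ℕ → ℝ) {M N : ℕ} (hMN : M ≤ N) :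
    ‖(∫ ω, expProd X n 0 N t ω ∂P) - ∫ ω, A.indicator (expProd X n M N t) ω ∂P‖
      ≤ P.real Aᶜ + ∫ ω, ‖expProd X n 0 M t ω - 1‖ ∂P := by
  have hint (k l : ℕ) : Integrable (expProd X n k l t) P :=
    Integrable.of_bound (measurable_expProd hX n k l t).aestronglyMeasurable 1
      (ae_of_all _ fun ω => (norm_expProd X n k l t ω).le)
  have hi1 : Integrable (Aᶜ.indicator (1 : Ω → ℝ)) P := (integrable_const 1).indicator hA.compl
  have hi2 : Integrable (fun ω => ‖expProd X n 0 M t ω - 1‖) P :=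
    ((hint 0 M).sub (integrable_const 1)).norm
  rw [← integral_sub (hint 0 N) ((hint M N).indicator hA), ← integral_indicator_one hA.compl,
    ← integral_add hi1 hi2]
  refine norm_integral_le_of_norm_le (hi1.add hi2) (ae_of_all _ fun ω => ?_)
  have hsplit : expProd X n 0 N t ω = expProd X n 0 M t ω * expProd X n M N t ω :=
    (Finset.prod_Ico_consecutive _ (Nat.zero_le M) hMN).symm
  rw [show expProd X n 0 N t ω - A.indicator (expProd X n M N t) ω
    = (expProd X n M N t ω - A.indicator (expProd X n M N t) ω)
      + (expProd X n 0 M t ω - 1) * expProd X n M N t ω by rw [hsplit]; ring]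
  refine (norm_add_le _ _).trans (add_le_add ?_ ?_)
  · by_cases hω : ω ∈ A <;> simp [hω, norm_expProd]
  · rw [norm_mul, norm_expProd, mul_one]

lemma tendsto_sum_Ico_of_isLittleO {ρ : ℝ → ℝ} (hρ0 : ∀ t, 0 ≤ ρ t)
    (hρ : ρ =o[𝓝 0] fun t : ℝ => |t| ^ α) {t : ℕ → ℕ → ℝ} {B : ℝ}
    (hsmall : ∀ δ > 0, ∀ᶠ N in atTop, ∀ j, |t N j| ≤ δ)
    (hsum : ∀ᶠ N in atTop, ∑ j ∈ Finset.range N, |t N j| ^ α = B) (M : ℕ) :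
    Tendsto (fun N => ∑ j ∈ Finset.Ico M N, ρ (t N j)) atTop (𝓝 0) := by
  rw [Metric.tendsto_nhds]
  intro ε hε
  -- The added 1 avoids division by zero and makes the final inequality strict.
  have hη : 0 < ε / (|B| + 1) := by positivity
  obtain ⟨δ, hδ, hball⟩ := Metric.eventually_nhds_iff.1 (hρ.def hη)
  filter_upwards [hsmall (δ / 2) (by positivity), hsum] with N hN hB
  rw [Real.dist_0_eq_abs, abs_of_nonneg (Finset.sum_nonneg fun _ _ => hρ0 _)]
  calc ∑ j ∈ Finset.Ico M N, ρ (t N j)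
      ≤ ∑ j ∈ Finset.Ico M N, ε / (|B| + 1) * |t N j| ^ α := by
        refine Finset.sum_le_sum fun j _ => ?_
        have h := hball (y := t N j) (by rw [Real.dist_0_eq_abs]; linarith [hN j])
        rwa [Real.norm_of_nonneg (hρ0 _), Real.norm_of_nonneg (by positivity)] at h
    _ ≤ ∑ j ∈ Finset.range N, ε / (|B| + 1) * |t N j| ^ α := by
        rw [Finset.range_eq_Ico]
        exact Finset.sum_le_sum_of_subset_of_nonneg
          (Finset.Ico_subset_Ico (Nat.zero_le M) le_rfl) fun _ _ _ => by positivity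
    _ = ε * (B / (|B| + 1)) := by
        rw [← Finset.mul_sum, hB]
        ring
    _ < ε := by
        have : B / (|B| + 1) < 1 := by
          rw [div_lt_one (by positivity)]
          linarith [le_abs_self B]
        nlinarith

/-- The product is exactly exp(-c(|s|^α - head)), where the head consists of the first `M` terms,
each tending to 0. -/
lemma tendsto_prod_Ico_stableCharFun (hα : 0 < α) {t : ℕ → ℕ → ℝ} {s : ℝ}
    (hsmall : ∀ δ > 0, ∀ᶠ N in atTop, ∀ j, |t N j| ≤ δ)
    (hsum : ∀ᶠ N in atTop, ∑ j ∈ Finset.range N, |t N j| ^ α = |s| ^ α) (M : ℕ) :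
    Tendsto (fun N => ∏ j ∈ Finset.Ico M N, stableCharFun α c (t N j)) atTop
      (𝓝 (stableCharFun α c s)) := by
  have hzero (j : ℕ) : Tendsto (fun N => t N j) atTop (𝓝 0) := by
    rw [Metric.tendsto_nhds]
    intro ε hε
    filter_upwards [hsmall (ε / 2) (by positivity)] with N hN
    rw [Real.dist_0_eq_abs]
    linarith [hN j]
  have hhead : Tendsto (fun N => ∑ j ∈ Finset.range M, |t N j| ^ α) atTop (𝓝 0) := by
    have h := tendsto_finsetSum (Finset.range M) fun j _ =>
      ((continuous_abs_rpow hα).tendsto 0).comp (hzero j)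
    simpa [Real.zero_rpow hα.ne', Function.comp_def] using h
  have hlim : Tendsto (fun N => Real.exp (-c * (|s| ^ α - ∑ j ∈ Finset.range M, |t N j| ^ α)))
      atTop (𝓝 (stableCharFun α c s)) := by
    have h := (Real.continuous_exp.tendsto _).comp ((hhead.const_sub (|s| ^ α)).const_mul (-c))
    simpa [stableCharFun, Function.comp_def] using h
  refine hlim.congr' ?_
  filter_upwards [hsum, eventually_ge_atTop M] with N hN hMN
  simp only [stableCharFun]
  rw [← Real.exp_sum, ← Finset.mul_sum, Finset.sum_Ico_eq_sub _ hMN, hN]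

/-- Convergence of the characteristic functions of weighted sums along the chosen subsequence, for
a triangular array of weights that is asymptotically negligible and normalized in `ℓ^α`. -/
lemma IsAlmostExchangeable.tendsto_integral_expProd [IsProbabilityMeasure P] [IsMarkovKernel μ]
    (hX : ∀ n, Measurable (X n)) (hα : 0 < α) (hc : 0 ≤ c)
    (hμS : ∀ᵐ ω ∂P, μ ω ∈ stableClass α c) {n : ℕ → ℕ}
    (hn : IsAlmostExchangeable P X μ (truncSet μ α c) n) {t : ℕ → ℕ → ℝ} {s : ℝ}
    (hsmall : ∀ δ > 0, ∀ᶠ N in atTop, ∀ j, |t N j| ≤ δ)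
    (hsum : ∀ᶠ N in atTop, ∑ j ∈ Finset.range N, |t N j| ^ α = |s| ^ α) :
    Tendsto (fun N => ∫ ω, expProd X n 0 N (t N) ω ∂P) atTop (𝓝 (stableCharFun α c s : ℂ)) := by
  have hzero : Tendsto t atTop (𝓝 0) := by
    rw [tendsto_pi_nhds]
    intro j
    rw [Metric.tendsto_nhds]
    intro ε hε
    filter_upwards [hsmall (ε / 2) (by positivity)] with N hN
    rw [Pi.zero_apply, Real.dist_0_eq_abs]
    linarith [hN j]
  rw [Metric.tendsto_nhds]
  intro ε hε
  -- Errors not vanishing as N → ∞: P(A_Mᶜ) enters once when the indicator is inserted and once when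
  -- P(A_M) is replaced by 1; the geometric tail from `M` is at most 2·2^{-M}. The same `M` is
  -- truncation level and number of dropped factors.
  have hM0 : Tendsto (fun M : ℕ => 2 * P.real (truncSet μ α c M)ᶜ + 2 * (1 / 2 : ℝ) ^ M) atTop
      (𝓝 0) := by
    have h := ((tendsto_measureReal_compl_truncSet hα hc hμS).const_mul 2).add
      ((tendsto_pow_atTop_nhds_zero_of_lt_one (by norm_num : (0 : ℝ) ≤ 1 / 2)
        (by norm_num)).const_mul 2)
    simpa using h
  obtain ⟨M, hM⟩ := (hM0.eventually_lt_const (half_pos hε)).exists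
  set A := truncSet μ α c M with hAdef
  have hA : MeasurableSet A := measurableSet_truncSet M
  set ρ : ℝ → ℝ := fun v => ∫ ω in A, ‖charFun (μ ω) v - (stableCharFun α c v : ℂ)‖ ∂P with hρ
  have hρ0 (v : ℝ) : 0 ≤ ρ v := integral_nonneg fun _ => norm_nonneg _
  have hhead : Tendsto (fun N => ∫ ω, ‖expProd X n 0 M (t N) ω - 1‖ ∂P) atTop (𝓝 0) := by
    have h := (tendsto_integral_norm_sub (P := P) (measurable_expProd hX n 0 M)
      (continuous_expProd X n 0 M) (fun t ω => (norm_expProd X n 0 M t ω).le) 0).comp hzero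
    have h1 (ω : Ω) : expProd X n 0 M 0 ω = 1 := by simp [expProd]
    simpa only [h1, Function.comp_def] using h
  have htail := tendsto_sum_Ico_of_isLittleO hρ0 (integral_truncSet_isLittleO hα hμS M) hsmall hsum M
  have hprod := (tendsto_iff_norm_sub_tendsto_zero.1
    (tendsto_prod_Ico_stableCharFun (c := c) hα hsmall hsum M))
  have hr := (hhead.add htail).add hprod
  simp only [add_zero] at hr
  filter_upwards [hr.eventually_lt_const (half_pos hε), hsmall 1 one_pos, eventually_ge_atTop M]
    with N hrN hN1 hMN
  have e1 := norm_integral_expProd_sub_le (P := P) hX hA n (t N) hMN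
  have e2 := hn.norm_integral_sub_le (α := α) hX hc (fun M => measurableSet_truncSet M) hN1 hMN
  rw [Finset.sum_add_distrib] at e2
  have hgeom : ∑ k ∈ Finset.Ico M N, (1 / 2 : ℝ) ^ k ≤ 2 * (1 / 2) ^ M :=
    (geom_sum_Ico_le_of_lt_one (by norm_num) (by norm_num)).trans (by
      rw [div_le_iff₀ (by norm_num)]
      linarith)
  have e3 : ‖(P.real A : ℂ) * ∏ j ∈ Finset.Ico M N, (stableCharFun α c (t N j) : ℂ)
      - (stableCharFun α c s : ℂ)‖ ≤ P.real Aᶜ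
        + ‖∏ j ∈ Finset.Ico M N, stableCharFun α c (t N j) - stableCharFun α c s‖ := by
    set p := ∏ j ∈ Finset.Ico M N, stableCharFun α c (t N j) with hp
    have hp0 : 0 ≤ p := Finset.prod_nonneg fun _ _ => (stableCharFun_pos _ _ _).le
    have hp1 : p ≤ 1 := Finset.prod_le_one (fun _ _ => (stableCharFun_pos _ _ _).le)
      fun _ _ => stableCharFun_le_one hc _ _
    have hcast : (P.real A : ℂ) * ∏ j ∈ Finset.Ico M N, (stableCharFun α c (t N j) : ℂ)
        - (stableCharFun α c s : ℂ) = ((-(P.real Aᶜ * p) + (p - stableCharFun α c s) : ℝ) : ℂ) := by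
      rw [probReal_compl_eq_one_sub hA, hp]
      push_cast
      ring
    rw [hcast, Complex.norm_real]
    refine (norm_add_le _ _).trans (add_le_add ?_ le_rfl)
    rw [norm_neg, Real.norm_of_nonneg (by positivity)]
    exact mul_le_of_le_one_right measureReal_nonneg hp1
  calc dist (∫ ω, expProd X n 0 N (t N) ω ∂P) (stableCharFun α c s : ℂ)
      ≤ dist (∫ ω, expProd X n 0 N (t N) ω ∂P) (∫ ω, A.indicator (expProd X n M N (t N)) ω ∂P)
        + dist (∫ ω, A.indicator (expProd X n M N (t N)) ω ∂P)
          ((P.real A : ℂ) * ∏ j ∈ Finset.Ico M N, (stableCharFun α c (t N j) : ℂ))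
        + dist ((P.real A : ℂ) * ∏ j ∈ Finset.Ico M N, (stableCharFun α c (t N j) : ℂ))
          (stableCharFun α c s : ℂ) := dist_triangle4 _ _ _ _
    _ < ε := by
      simp only [dist_eq_norm]
      linarith

lemma abs_le_weightMax (a : ℕ → ℝ) {j N : ℕ} (hj : j < N) : |a j| ≤ weightMax a N := by
  have h := Finset.le_sup (f := fun k => ‖a k‖₊) (Finset.mem_range.2 hj)
  exact_mod_cast h

lemma weightMax_nonneg (a : ℕ → ℝ) (N : ℕ) : 0 ≤ weightMax a N := NNReal.coe_nonneg _

lemma weightNorm_rpow (hα : 0 < α) (a : ℕ → ℝ) (N : ℕ) :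
    weightNorm α a N ^ α = ∑ k ∈ Finset.range N, |a k| ^ α := by
  rw [weightNorm, ← Real.rpow_mul (Finset.sum_nonneg fun _ _ => by positivity),
    one_div_mul_cancel hα.ne', Real.rpow_one]

lemma eventually_weightNorm_pos (α : ℝ) {a : ℕ → ℝ} (ha : ∃ k, a k ≠ 0) :
    ∀ᶠ N in atTop, 0 < weightNorm α a N := by
  obtain ⟨k, hk⟩ := ha
  filter_upwards [eventually_gt_atTop k] with N hN
  refine Real.rpow_pos_of_pos ?_ _
  exact Finset.sum_pos' (fun _ _ => by positivity)
    ⟨k, Finset.mem_range.2 hN, Real.rpow_pos_of_pos (abs_pos.2 hk) α⟩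

lemma integral_expProd_eq_charFun (hX : ∀ n, Measurable (X n)) (n : ℕ → ℕ)
    (a : ℕ → ℝ) (r s : ℝ) (N : ℕ) :
    charFun (P.map fun ω => r * ∑ k ∈ Finset.range N, a k * X (n k) ω) s
      = ∫ ω, expProd X n 0 N (fun j => if j < N then s * a j * r else 0) ω ∂P := by
  rw [charFun_map_eq_integral (by fun_prop)]
  congr 1
  ext ω
  rw [expProd, ← Complex.exp_sum, ← Finset.range_eq_Ico]
  congr 1
  push_cast
  rw [Finset.mul_sum, Finset.mul_sum, Finset.sum_mul]
  refine Finset.sum_congr rfl fun j hj => ?_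
  rw [if_pos (Finset.mem_range.1 hj)]
  push_cast
  ring

lemma IsAlmostExchangeable.tendsto_charFun [IsProbabilityMeasure P] [IsMarkovKernel μ]
    (hX : ∀ n, Measurable (X n)) (hα : 0 < α) (hc : 0 ≤ c)
    (hμS : ∀ᵐ ω ∂P, μ ω ∈ stableClass α c) {n : ℕ → ℕ}
    (hn : IsAlmostExchangeable P X μ (truncSet μ α c) n) {a : ℕ → ℝ} (ha : ∃ k, a k ≠ 0)
    (hmax : weightMax a =o[atTop] weightNorm α a) (s : ℝ) :
    Tendsto (fun N => charFun (P.map fun ω => (weightNorm α a N)⁻¹ *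
      ∑ k ∈ Finset.range N, a k * X (n k) ω) s) atTop (𝓝 (stableCharFun α c s : ℂ)) := by
  simp_rw [integral_expProd_eq_charFun hX]
  -- Padding by 0 beyond `N` gives the smallness bound for all `j`, as the selection property
  -- demands, without affecting the product.
  refine hn.tendsto_integral_expProd (t := fun N j =>
    if j < N then s * a j * (weightNorm α a N)⁻¹ else 0) hX hα hc hμS (fun δ hδ => ?_) ?_
  · have h := hmax.def (show 0 < δ / (|s| + 1) by positivity)
    filter_upwards [h, eventually_weightNorm_pos α ha] with N hN hpos j
    by_cases hj : j < N
    · rw [if_pos hj, abs_mul, abs_mul, abs_inv, abs_of_pos hpos, ← div_eq_mul_inv,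
        div_le_iff₀ hpos]
      rw [Real.norm_of_nonneg (weightMax_nonneg a N), Real.norm_of_nonneg hpos.le] at hN
      calc |s| * |a j| ≤ |s| * (δ / (|s| + 1) * weightNorm α a N) := by
            gcongr
            exact (abs_le_weightMax a hj).trans hN
        _ = (|s| / (|s| + 1)) * (δ * weightNorm α a N) := by ring
        _ ≤ δ * weightNorm α a N := by
            refine mul_le_of_le_one_left (by positivity) ?_
            rw [div_le_one (by positivity)]
            linarith
    · rw [if_neg hj, abs_zero]
      exact hδ.le
  · filter_upwards [eventually_weightNorm_pos α ha] with N hpos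
    have hpow : weightNorm α a N ^ α ≠ 0 := (Real.rpow_pos_of_pos hpos α).ne'
    calc _ = ∑ j ∈ Finset.range N, |s| ^ α * (weightNorm α a N ^ α)⁻¹ * |a j| ^ α := by
          refine Finset.sum_congr rfl fun j hj => ?_
          rw [if_pos (Finset.mem_range.1 hj), abs_mul, abs_mul, abs_inv, abs_of_pos hpos,
            Real.mul_rpow (by positivity) (by positivity), Real.mul_rpow (by positivity)
            (by positivity), Real.inv_rpow hpos.le]
          ring
      _ = |s| ^ α := by
          rw [← Finset.mul_sum, ← weightNorm_rpow hα, mul_assoc, inv_mul_cancel₀ hpow, mul_one]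

lemma weightMax_one_isLittleO (hα : 0 < α) :
    weightMax (fun _ => 1) =o[atTop] weightNorm α (fun _ => 1) := by
  have h1 : weightMax (fun _ => 1) =O[atTop] fun _ : ℕ => (1 : ℝ) := by
    refine IsBigO.of_bound 1 (Eventually.of_forall fun N => ?_)
    rw [Real.norm_of_nonneg (weightMax_nonneg _ N), norm_one, mul_one]
    have : (Finset.range N).sup (fun _ => ‖(1 : ℝ)‖₊) ≤ 1 := Finset.sup_le fun _ _ => by simp
    exact NNReal.coe_le_coe.2 this
  refine h1.trans_isLittleO ?_
  rw [isLittleO_const_left]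
  right
  have h2 : Tendsto (fun N : ℕ => (N : ℝ) ^ (1 / α)) atTop atTop :=
    (tendsto_rpow_atTop (by positivity)).comp tendsto_natCast_atTop_atTop
  refine tendsto_norm_atTop_atTop.comp (h2.congr fun N => ?_)
  simp [weightNorm]

/-- If characteristic functions converge pointwise to a function continuous at `0`, then this
function is a characteristic function. -/
lemma exists_probabilityMeasure_of_tendsto_charFun {ν : ℕ → Measure ℝ}
    [∀ i, IsProbabilityMeasure (ν i)] {f : ℝ → ℂ} (hf : ContinuousAt f 0)
    (h : ∀ t, Tendsto (fun n => charFun (ν n) t) atTop (𝓝 (f t))) :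
    ∃ G : ProbabilityMeasure ℝ, ∀ t, charFun (G : Measure ℝ) t = f t := by
  -- Tightness and Prokhorov give a weakly convergent subsequence; its limit must have
  -- characteristic function `f`.
  have htight := isTightMeasureSet_of_tendsto_charFun hf h
  let ρ : ℕ → ProbabilityMeasure ℝ := fun n => ⟨ν n, inferInstance⟩
  have hcomp : IsCompact (closure (Set.range ρ)) := by
    refine isCompact_closure_of_isTightMeasureSet (htight.subset ?_)
    rintro _ ⟨_, ⟨n, rfl⟩, rfl⟩
    exact ⟨n, rfl⟩
  obtain ⟨G, -, φ, hφ, hG⟩ := hcomp.tendsto_subseq fun n => subset_closure ⟨n, rfl⟩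
  refine ⟨G, fun t => ?_⟩
  exact tendsto_nhds_unique (ProbabilityMeasure.tendsto_iff_tendsto_charFun.1 hG t)
    ((h t).comp hφ.tendsto_atTop)

end

end SubseqStable

end

theorem theorem2 {Ω : Type*} [MeasurableSpace Ω] (P : Measure Ω) [IsProbabilityMeasure P]
    (α c : ℝ) (hα0 : 0 < α) (hα2 : α < 2) (hc : 0 < c)
    (X : ℕ → Ω → ℝ) (hX : ∀ n, Measurable (X n))
    (hdet : SubseqStable.IsDetermining P X)
    (μ : Kernel Ω ℝ) (hμ : SubseqStable.IsLimitRandomMeasure P X μ)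
    (hμS : ∀ᵐ ω ∂P, μ ω ∈ SubseqStable.stableClass α c) :
    ∃ G : ProbabilityMeasure ℝ,
      (∀ t : ℝ, charFun (G : Measure ℝ) t = ((Real.exp (-c * |t| ^ α) : ℝ) : ℂ)) ∧
      ∃ n : ℕ → ℕ, StrictMono n ∧
        ∀ a : ℕ → ℝ, (∃ k, a k ≠ 0) →
          SubseqStable.weightMax a =o[atTop] SubseqStable.weightNorm α a →
          TendstoInDistribution
            (fun (N : ℕ) (ω : Ω) => (SubseqStable.weightNorm α a N)⁻¹ *
              ∑ k ∈ Finset.range N, a k * X (n k) ω)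
            atTop (id : ℝ → ℝ) (fun _ => P) (G : Measure ℝ) := by
  have := hμ.1
  obtain ⟨n, hmono, hn⟩ := hμ.exists_isAlmostExchangeable hX
    (A := SubseqStable.truncSet μ α c) SubseqStable.measurableSet_truncSet
  have hmeas (a : ℕ → ℝ) (N : ℕ) : Measurable fun ω => (SubseqStable.weightNorm α a N)⁻¹ *
      ∑ k ∈ Finset.range N, a k * X (n k) ω := by fun_prop
  have hprob (a : ℕ → ℝ) (N : ℕ) : IsProbabilityMeasure
      (P.map fun ω => (SubseqStable.weightNorm α a N)⁻¹ * ∑ k ∈ Finset.range N, a k * X (n k) ω) :=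
    Measure.isProbabilityMeasure_map (hmeas a N).aemeasurable
  -- The stable law is obtained from the convergence itself: constant weights 1 are admissible,
  -- since their maximum stays bounded while A_N = N^{1/α} → ∞.
  obtain ⟨G, hG⟩ := SubseqStable.exists_probabilityMeasure_of_tendsto_charFun
    (f := fun s => (SubseqStable.stableCharFun α c s : ℂ))
    (Complex.continuous_ofReal.comp
      (SubseqStable.continuous_stableCharFun hα0 c)).continuousAt
    (hn.tendsto_charFun hX hα0 hc.le hμS (a := fun _ => 1) ⟨0, one_ne_zero⟩
      (SubseqStable.weightMax_one_isLittleO hα0))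
  refine ⟨G, hG, n, hmono, fun a ha hmax => ?_⟩
  refine ⟨fun N => (hmeas a N).aemeasurable, aemeasurable_id, ?_⟩
  refine ProbabilityMeasure.tendsto_iff_tendsto_charFun.2 fun s => ?_
  change Tendsto (fun N => charFun (P.map fun ω => (SubseqStable.weightNorm α a N)⁻¹ *
    ∑ k ∈ Finset.range N, a k * X (n k) ω) s) atTop (𝓝 (charFun ((G : Measure ℝ).map id) s))
  rw [Measure.map_id, hG s]
  exact hn.tendsto_charFun hX hα0 hc.le hμS ha hmax s
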